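/- Let $k$ be a field, $V$ a finite-dimensional $k$-vector space, $N\ge 2$ an integer, and $R\subseteq V^{\otimes N}$ a subspace. Let $A=\mathrm{Tens}(V)/I(R)$ be the $N$-homogeneous algebra on $V$ with space of relations $R$ (where $I(R)$ is the two-sided ideal generated by $R$), graded with $V$ in degree $1$, and let $A^!=\mathrm{Tens}(V^*)/I(R^\perp)$ be its dual, where $R^\perp\subseteq (V^*)^{\otimes N}$ is the orthogonal of $R$ for the pairing $\langle\alpha_1\otimes\cdots\otimes\alpha_N,\,v_1\otimes\cdots\otimes v_N\rangle=\alpha_1(v_1)\cdots\alpha_N(v_N)$. Put $n(2q)=qN$ and $n(2q+1)=qN+1$ for $q\ge 0$. Assume that $A$ is Koszul in the generalized sense: for every $i\ge 3$ the graded vector space $\mathrm{Tor}^A_i(k,k)$ is concentrated in degree $n(i)$. Here $k$ is the trivial module via the augmentation $\varepsilon:A\to k$ that vanishes on $V$. Let $(e_l)$ be a basis of $V$ with dual basis $(e_l^*)$, and for $m\ge 0$ let $d:A\otimes (A^!_{m+1})^*\to A\otimes (A^!_m)^*$ be given by $d(a\otimes\alpha)=\sum_l ae_l\otimes \alpha\cdot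 e_l^*$, with $\langle\alpha\cdot e_l^*,f\rangle=\langle\alpha,e_l^*f\rangle$. Let $P$ be the sequence of left $A$-modules $P_i=A\otimes (A^!_{n(i)})^*$, $i\ge 0$, with maps $\delta_{i+1}:P_{i+1}\to P_i$ equal to $d$ if $i$ is even and to $d^{N-1}$ if $i$ is odd, and with augmentation $P_0\to k$, $a\otimes\alpha\mapsto\varepsilon(a)\langle\alpha,1\rangle$, also denoted by $\varepsilon$. Then $P\to k$ is a projective resolution of $k$. Let $E(A)_i=\mathrm{Ext}^i_A(k,k)=H^i(\mathrm{Hom}_A(P,k))$. For each $i\ge 0$, sending $f\in A^!_{n(i)}$ to the class of the cocycle $a\otimes\alpha\mapsto\varepsilon(a)\langle\alpha,f\rangle$ is an isomorphism of vector spaces $A^!_{n(i)}\cong E(A)_i$, by which these spaces are identified. Let $\bullet$ be the Yoneda product $[f]\bullet[g]=[f\circ\tilde g]$, where, for a cocycle $g:P_j\to k$, $\tilde g=(\tilde g_l:P_{l+j}\to P_l)_{l\ge 0}$ is any family of $A$-linear maps with $\varepsilon\circ\tilde g_0=g$ and $\delta_{l+1}\circ\tilde g_{l+1}=(-1)^j\,\tilde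 g_l\circ\delta_{l+j+1}$ for all $l\ge 0$. Equivalently, $\tilde g$ is a cycle of degree $-j$ of $\mathrm{Hom}_A(P,P)$, with differential the graded commutator with $\delta$, such that $\varepsilon\circ\tilde g=g$. Then for all $i,j\ge 0$, $f\in E(A)_i=A^!_{n(i)}$ and $g\in E(A)_j=A^!_{n(j)}$, writing $fg$ for the product in $A^!$, $$f\bullet g=\begin{cases}(-1)^{ij}\,fg & \text{if } N=2,\text{ or } N>2 \text{ and } i \text{ or } j \text{ is even},\\ 0 & \text{if } N>2 \text{ and } i,j \text{ are both odd}.\end{cases}$$ In the first case $fg$ does lie in $A^!_{n(i+j)}$. -/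

import Mathlib

open scoped TensorProduct

universe u v w

noncomputable section

/-! ### Resolutions, Ext and the Yoneda product -/

/-- A sequence `⋯ → X 2 → X 1 → X 0 → M` of left modules over a (noncommutative) ring `A`.
That it is a complex, and exact, is part of `AugmentedSequence.IsProjectiveResolution`. -/
structure AugmentedSequence (A : Type u) [Ring A] (M : Type v) [AddCommGroup M] [Module A M] where
  /-- the terms -/
  X : ℕ → Type w
  [instAddCommGroup : ∀ i, AddCommGroup (X i)]
  [instModule : ∀ i, Module A (X i)]
  /-- the differential `X (i + 1) → X i` -/
  d : ∀ i, X (i + 1) →ₗ[A] X i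
  /-- the augmentation -/
  aug : X 0 →ₗ[A] M

attribute [instance] AugmentedSequence.instAddCommGroup AugmentedSequence.instModule

namespace AugmentedSequence

variable {A : Type u} [Ring A] {M : Type v} [AddCommGroup M] [Module A M]
  (P : AugmentedSequence.{u, v, w} A M)

/-- `⋯ → X 1 → X 0 → M → 0` is exact with projective terms `X i`. -/
structure IsProjectiveResolution : Prop where
  projective : ∀ i, Module.Projective A (P.X i)
  aug_surjective : Function.Surjective P.aug
  exact_zero : Function.Exact (P.d 0) P.aug
  exact_succ : ∀ i, Function.Exact (P.d (i + 1)) (P.d i)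

variable (K : Type*) [CommRing K] [Module K M] [SMulCommClass A K M]

/-- The cocycles of degree `i` of the complex `Hom_A(P, M)`. -/
def cocycles (i : ℕ) : Submodule K (P.X i →ₗ[A] M) where
  carrier := {f | f ∘ₗ P.d i = 0}
  add_mem' := by
    intro f g hf hg
    simp only [Set.mem_ofPred_eq] at *
    rw [LinearMap.add_comp, hf, hg, add_zero]
  zero_mem' := LinearMap.zero_comp _
  smul_mem' := by
    intro c f hf
    simp only [Set.mem_ofPred_eq] at *
    rw [LinearMap.smul_comp, hf, smul_zero]

/-- The coboundaries of degree `i` of the complex `Hom_A(P, M)`. -/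
def coboundaries : ∀ i : ℕ, Submodule K (P.X i →ₗ[A] M)
  | 0 => ⊥
  | i + 1 =>
    { carrier := {f | ∃ g : P.X i →ₗ[A] M, f = g ∘ₗ P.d i}
      add_mem' := by
        rintro _ _ ⟨g, rfl⟩ ⟨g', rfl⟩
        exact ⟨g + g', (LinearMap.add_comp _ _ _).symm⟩
      zero_mem' := ⟨0, (LinearMap.zero_comp _).symm⟩
      smul_mem' := by
        rintro c _ ⟨g, rfl⟩
        exact ⟨c • g, (LinearMap.smul_comp _ _ _).symm⟩ }

/-- `Ext_A^i(M, M)`, as the `i`-th cohomology of `Hom_A(P, M)`; meant for a projective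
resolution `P` of `M`. -/
abbrev Ext (i : ℕ) : Type _ :=
  P.cocycles K i ⧸ (P.coboundaries K i).submoduleOf (P.cocycles K i)

/-- The class of a cocycle. -/
def extMk (i : ℕ) : P.cocycles K i →ₗ[K] P.Ext K i :=
  ((P.coboundaries K i).submoduleOf (P.cocycles K i)).mkQ

theorem extMk_eq_iff {i : ℕ} (f f' : P.cocycles K i) :
    P.extMk K i f = P.extMk K i f' ↔ f.1 - f'.1 ∈ P.coboundaries K i :=
  Submodule.Quotient.eq _

/-- `g'` is a homogeneous element of degree `-j` of `Hom_A(P, P)`, with components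
`P.X m → P.X l` for `l + j = m`. It is a cycle for the differential
`φ ↦ d ∘ φ - (-1)^{deg φ} φ ∘ d` (first condition) and its composition with the augmentation
is `g` (second condition). -/
structure IsLift {j : ℕ} (g : P.X j →ₗ[A] M)
    (g' : ∀ m l : ℕ, l + j = m → (P.X m →ₗ[A] P.X l)) : Prop where
  cycle : ∀ (m l : ℕ) (h : l + j = m),
    P.d l ∘ₗ g' (m + 1) (l + 1) (by omega) = (-1 : ℤ) ^ j • (g' m l h ∘ₗ P.d m)
  aug_comp : P.aug ∘ₗ g' j 0 (by omega) = g

/-- `z` is a Yoneda product `[f] • [g] = [f ∘ g']` of `x = [f]` and `y = [g]`, where `g'` is a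
cycle of `Hom_A(P, P)` lifting `g`. -/
def IsYonedaProduct {i j : ℕ} (x : P.Ext K i) (y : P.Ext K j) (z : P.Ext K (i + j)) : Prop :=
  ∃ (f : P.cocycles K i) (g : P.cocycles K j) (h : P.cocycles K (i + j))
    (g' : ∀ m l : ℕ, l + j = m → (P.X m →ₗ[A] P.X l)),
    P.IsLift g.1 g' ∧ h.1 = f.1 ∘ₗ g' (i + j) i rfl ∧
      P.extMk K i f = x ∧ P.extMk K j g = y ∧ P.extMk K (i + j) h = z

/-- `t` factors through the differential `X m → X (m - 1)`. -/
def IsCob {Y : Type*} [AddCommGroup Y] [Module A Y] : ∀ m : ℕ, (P.X m →ₗ[A] Y) → Prop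
  | 0, t => t = 0
  | m + 1, t => ∃ g : P.X m →ₗ[A] Y, t = g ∘ₗ P.d m

theorem mem_coboundaries_iff (i : ℕ) (f : P.X i →ₗ[A] M) :
    f ∈ P.coboundaries K i ↔ P.IsCob i f := by
  cases i with
  | zero => exact Submodule.mem_bot K
  | succ i => exact Iff.rfl

theorem exists_comp_eq {X Y Z W : Type*} [AddCommGroup X] [AddCommGroup Y] [AddCommGroup Z]
    [AddCommGroup W] [Module A X] [Module A Y] [Module A Z] [Module A W] [Module.Projective A W]
    {f : X →ₗ[A] Y} {g : Y →ₗ[A] Z} (h : Function.Exact f g) (φ : W →ₗ[A] Y)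
    (hφ : g ∘ₗ φ = 0) : ∃ ψ : W →ₗ[A] X, f ∘ₗ ψ = φ := by
  obtain ⟨ψ, hψ⟩ := Module.projective_lifting_property f.rangeRestrict
    (φ.codRestrict (LinearMap.range f) fun w => (h (φ w)).1 (LinearMap.congr_fun hφ w))
    f.surjective_rangeRestrict
  refine ⟨ψ, ?_⟩
  ext w
  exact congrArg Subtype.val (LinearMap.congr_fun hψ w)

theorem exact_comp {X Y Z : Type*} [AddCommGroup X] [AddCommGroup Y] [AddCommGroup Z]
    [Module A X] [Module A Y] [Module A Z] {f : X →ₗ[A] Y} {g : Y →ₗ[A] Z}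
    (h : Function.Exact f g) : g ∘ₗ f = 0 :=
  LinearMap.ext fun x => h.apply_apply_eq_zero x

namespace IsProjectiveResolution

variable {P}

theorem exists_lift (hP : P.IsProjectiveResolution) {j : ℕ} (g : P.cocycles K j) :
    ∃ g' : ∀ m l : ℕ, l + j = m → (P.X m →ₗ[A] P.X l), P.IsLift g.1 g' := by
  have hpr := hP.projective
  let Q : ∀ l : ℕ, (∀ m, l + j = m → (P.X m →ₗ[A] P.X l)) → Prop := fun l =>
    match l with
    | 0 => fun φ => ∀ m h, P.aug ∘ₗ (φ m h ∘ₗ P.d m) = 0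
    | l + 1 => fun φ => ∀ m h, P.d l ∘ₗ (φ m h ∘ₗ P.d m) = 0
  have base : ∃ φ : ∀ m, 0 + j = m → (P.X m →ₗ[A] P.X 0), Q 0 φ ∧
      P.aug ∘ₗ φ j (by omega) = g.1 := by
    obtain ⟨ψ, hψ⟩ := Module.projective_lifting_property P.aug g.1 hP.aug_surjective
    have e : ∀ m, 0 + j = m → j = m := fun m h => by omega
    refine ⟨fun m h => (e m h) ▸ ψ, ?_, hψ⟩
    intro m h
    obtain rfl := e m h
    rw [← LinearMap.comp_assoc, hψ]
    exact g.2
  have step : ∀ (l : ℕ) (s : {φ // Q l φ}), ∃ s' : {φ // Q (l + 1) φ},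
      ∀ m (h : l + j = m), P.d l ∘ₗ s'.1 (m + 1) (by omega) =
        (-1 : ℤ) ^ j • (s.1 m h ∘ₗ P.d m) := by
    rintro l ⟨φ, hφ⟩
    obtain ⟨ψ, hψ⟩ : ∃ ψ : P.X (l + j + 1) →ₗ[A] P.X (l + 1),
        P.d l ∘ₗ ψ = (-1 : ℤ) ^ j • (φ (l + j) rfl ∘ₗ P.d (l + j)) := by
      cases l with
      | zero =>
        refine exists_comp_eq hP.exact_zero _ ?_
        rw [LinearMap.comp_smul, hφ, smul_zero]
      | succ l =>
        refine exists_comp_eq (hP.exact_succ l) _ ?_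
        rw [LinearMap.comp_smul, hφ, smul_zero]
    have e : ∀ m, l + 1 + j = m → l + j + 1 = m := fun m h => by omega
    refine ⟨⟨fun m h => (e m h) ▸ ψ, ?_⟩, ?_⟩
    · intro m h
      obtain rfl := e m h
      rw [← LinearMap.comp_assoc, hψ, LinearMap.smul_comp, LinearMap.comp_assoc,
        exact_comp (hP.exact_succ _), LinearMap.comp_zero, smul_zero]
    · rintro m rfl
      exact hψ
  obtain ⟨φ₀, hQ, haug⟩ := base
  choose next hnext using step
  let s : ∀ l, {φ // Q l φ} := fun l => Nat.rec ⟨φ₀, hQ⟩ (fun l s => next l s) l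
  exact ⟨fun m l h => (s l).1 m h, fun m l h => hnext l (s l) m h, haug⟩

theorem isCob_comp_lift (hP : P.IsProjectiveResolution) {j : ℕ}
    (u : ∀ m l : ℕ, l + j = m → (P.X m →ₗ[A] P.X l))
    (hu : ∀ (m l : ℕ) (h : l + j = m),
      P.d l ∘ₗ u (m + 1) (l + 1) (by omega) = (-1 : ℤ) ^ j • (u m l h ∘ₗ P.d m))
    (h0 : P.IsCob j (P.aug ∘ₗ u j 0 (by omega))) (l m : ℕ) (h : l + j = m) :
    ∃ (s : P.X m →ₗ[A] P.X (l + 1)) (t : P.X m →ₗ[A] P.X l),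
      P.IsCob m t ∧ u m l h = P.d l ∘ₗ s + t := by
  have hpr := hP.projective
  induction l generalizing m with
  | zero =>
    obtain rfl : j = m := by omega
    obtain ⟨t, ht, htu⟩ : ∃ t : P.X j →ₗ[A] P.X 0, P.IsCob j t ∧
        P.aug ∘ₗ t = P.aug ∘ₗ u j 0 h := by
      cases j with
      | zero => exact ⟨0, rfl, by rw [LinearMap.comp_zero]; exact h0.symm⟩
      | succ j =>
        obtain ⟨b, hb⟩ := h0
        obtain ⟨γ, hγ⟩ := Module.projective_lifting_property P.aug b hP.aug_surjective
        exact ⟨γ ∘ₗ P.d j, ⟨γ, rfl⟩, by rw [← LinearMap.comp_assoc, hγ, hb]⟩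
    obtain ⟨s, hs⟩ := exists_comp_eq hP.exact_zero (u j 0 h - t)
      (by rw [LinearMap.comp_sub, htu, sub_self])
    exact ⟨s, t, ht, by rw [hs, sub_add_cancel]⟩
  | succ l ih =>
    obtain ⟨m, rfl⟩ : ∃ m', m = m' + 1 := ⟨l + j, by omega⟩
    have h' : l + j = m := by omega
    obtain ⟨s, t, ht, hst⟩ := ih m h'
    have htd : t ∘ₗ P.d m = 0 := by
      cases m with
      | zero => rw [show t = 0 from ht, LinearMap.zero_comp]
      | succ m =>
        obtain ⟨b, rfl⟩ := ht
        rw [LinearMap.comp_assoc, exact_comp (hP.exact_succ _), LinearMap.comp_zero]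
    obtain ⟨s', hs'⟩ := exists_comp_eq (hP.exact_succ l)
      (u (m + 1) (l + 1) h - (-1 : ℤ) ^ j • (s ∘ₗ P.d m))
      (by rw [LinearMap.comp_sub, hu m l h', hst, LinearMap.add_comp, htd, add_zero,
            LinearMap.comp_smul, LinearMap.comp_assoc, sub_self])
    exact ⟨s', (-1 : ℤ) ^ j • (s ∘ₗ P.d m), ⟨(-1 : ℤ) ^ j • s, by rw [LinearMap.smul_comp]⟩,
      by rw [hs', sub_add_cancel]⟩

theorem existsUnique_yonedaProduct (hP : P.IsProjectiveResolution)
    {i j : ℕ} (x : P.Ext K i) (y : P.Ext K j) : ∃! z, P.IsYonedaProduct K x y z := by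
  obtain ⟨f, rfl⟩ : ∃ f, P.extMk K i f = x := Submodule.mkQ_surjective _ x
  obtain ⟨g, rfl⟩ : ∃ g, P.extMk K j g = y := Submodule.mkQ_surjective _ y
  obtain ⟨g', hg'⟩ := hP.exists_lift K g
  have hc : f.1 ∘ₗ g' (i + j) i rfl ∈ P.cocycles K (i + j) := by
    change (f.1 ∘ₗ g' (i + j) i rfl) ∘ₗ P.d (i + j) = 0
    have h1 : g' (i + j) i rfl ∘ₗ P.d (i + j) =
        (-1 : ℤ) ^ j • (P.d i ∘ₗ g' (i + j + 1) (i + 1) (by omega)) := by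
      rw [hg'.cycle (i + j) i rfl, smul_smul, ← mul_pow]
      simp
    rw [LinearMap.comp_assoc, h1, LinearMap.comp_smul, ← LinearMap.comp_assoc,
      show f.1 ∘ₗ P.d i = 0 from f.2, LinearMap.zero_comp, smul_zero]
  refine ⟨P.extMk K (i + j) ⟨_, hc⟩, ⟨f, g, ⟨_, hc⟩, g', hg', rfl, rfl, rfl, rfl⟩, ?_⟩
  rintro z ⟨f₁, g₁, h₁, g₁', hg₁', hh₁, hf, hg, rfl⟩
  rw [extMk_eq_iff] at hf hg ⊢
  have e : h₁.1 - f.1 ∘ₗ g' (i + j) i rfl =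
      (f₁.1 - f.1) ∘ₗ g₁' (i + j) i rfl + f.1 ∘ₗ (g₁' (i + j) i rfl - g' (i + j) i rfl) := by
    rw [hh₁, LinearMap.sub_comp, LinearMap.comp_sub]
    abel
  change h₁.1 - f.1 ∘ₗ g' (i + j) i rfl ∈ _
  rw [e]
  refine add_mem ?_ ?_
  · rw [mem_coboundaries_iff] at hf ⊢
    suffices H : ∀ m h, P.IsCob m ((f₁.1 - f.1) ∘ₗ g₁' m i h) from H _ rfl
    intro m hm
    cases i with
    | zero =>
      rw [show f₁.1 - f.1 = 0 from hf, LinearMap.zero_comp, ← mem_coboundaries_iff P K]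
      exact zero_mem _
    | succ i =>
      obtain ⟨a, ha⟩ := hf
      obtain ⟨m, rfl⟩ : ∃ m', m = m' + 1 := ⟨i + j, by omega⟩
      refine ⟨(-1 : ℤ) ^ j • (a ∘ₗ g₁' m i (by omega)), ?_⟩
      rw [ha, LinearMap.comp_assoc, hg₁'.cycle m i (by omega), LinearMap.comp_smul,
        LinearMap.smul_comp, LinearMap.comp_assoc]
  · obtain ⟨s, t, ht, hst⟩ := hP.isCob_comp_lift (fun m l h => g₁' m l h - g' m l h)
      (fun m l h => by
        rw [LinearMap.comp_sub, hg₁'.cycle m l h, hg'.cycle m l h, LinearMap.sub_comp, smul_sub])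
      (by
        rw [LinearMap.comp_sub, hg₁'.aug_comp, hg'.aug_comp, ← mem_coboundaries_iff P K]
        exact hg) i (i + j) rfl
    have hst' : g₁' (i + j) i rfl - g' (i + j) i rfl = P.d i ∘ₗ s + t := hst
    clear hst
    rw [hst', LinearMap.comp_add, ← LinearMap.comp_assoc, show f.1 ∘ₗ P.d i = 0 from f.2,
      LinearMap.zero_comp, zero_add, mem_coboundaries_iff]
    clear hst' e hc hh₁
    generalize i + j = m at s t ht ⊢
    cases m with
    | zero => rw [show t = 0 from ht, LinearMap.comp_zero]; rfl
    | succ m =>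
      obtain ⟨b, rfl⟩ := ht
      exact ⟨f.1 ∘ₗ b, (LinearMap.comp_assoc _ _ _).symm⟩

/-- The Yoneda product `Ext^i × Ext^j → Ext^{i+j}`. -/
def yonedaMul (hP : P.IsProjectiveResolution) {i j : ℕ} (x : P.Ext K i) (y : P.Ext K j) :
    P.Ext K (i + j) :=
  (hP.existsUnique_yonedaProduct K x y).choose

theorem yonedaMul_eq_iff (hP : P.IsProjectiveResolution)
    {i j : ℕ} (x : P.Ext K i) (y : P.Ext K j) (z : P.Ext K (i + j)) :
    hP.yonedaMul K x y = z ↔ P.IsYonedaProduct K x y z :=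
  ⟨fun h => h ▸ (hP.existsUnique_yonedaProduct K x y).choose_spec.1,
    fun h => ((hP.existsUnique_yonedaProduct K x y).choose_spec.2 z h).symm⟩

end IsProjectiveResolution

end AugmentedSequence

/-! ### Homogeneous algebras -/

/-- The `N`-homogeneous algebra `Tens(V) / I(R)` on `V` with space of relations `R ⊆ V^{⊗N}`. -/
def HomogeneousAlgebra {k : Type u} [Field k] {V : Type v} [AddCommGroup V] [Module k V] {N : ℕ}
    (R : Submodule k (⨂[k]^N V)) : Type (max u v) :=
  RingQuot fun x y : TensorAlgebra k V => (∃ r ∈ R, x = TensorPower.toTensorAlgebra r) ∧ y = 0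

namespace HomogeneousAlgebra

variable {k : Type u} [Field k] {V : Type v} [AddCommGroup V] [Module k V] {N : ℕ}
  (R : Submodule k (⨂[k]^N V))

instance : Ring (HomogeneousAlgebra R) := inferInstanceAs (Ring (RingQuot _))

instance : Algebra k (HomogeneousAlgebra R) := inferInstanceAs (Algebra k (RingQuot _))

/-- The quotient map `Tens(V) → A`. -/
def mk : TensorAlgebra k V →ₐ[k] HomogeneousAlgebra R :=
  RingQuot.mkAlgHom k _

/-- The canonical map `V → A`. -/
def ι : V →ₗ[k] HomogeneousAlgebra R :=
  (mk R).toLinearMap ∘ₗ TensorAlgebra.ι k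

/-- The homogeneous component `A_n`, that is, the image of `V^{⊗n}` in `A`. -/
def component (n : ℕ) : Submodule k (HomogeneousAlgebra R) :=
  LinearMap.range ((mk R).toLinearMap ∘ₗ TensorPower.toTensorAlgebra (n := n))

theorem component_eq_pow (n : ℕ) : component R n = LinearMap.range (ι R) ^ n := by
  have h : LinearMap.range (TensorPower.toTensorAlgebra (R := k) (M := V) (n := n)) =
      LinearMap.range (TensorAlgebra.ι k (M := V)) ^ n := by
    apply le_antisymm
    · rw [LinearMap.range_eq_map, ← PiTensorProduct.span_tprod_eq_top, Submodule.map_span,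
        Submodule.span_le]
      rintro _ ⟨_, ⟨x, rfl⟩, rfl⟩
      rw [TensorPower.toTensorAlgebra_tprod, TensorAlgebra.tprod_apply]
      induction n with
      | zero => simp [Submodule.one_le.1 le_rfl]
      | succ n ih =>
        rw [List.ofFn_succ, List.prod_cons, pow_succ']
        exact Submodule.mul_mem_mul (LinearMap.mem_range_self _ _) (ih _)
    · rw [Submodule.pow_eq_span_pow_set, Submodule.span_le]
      intro y hy
      rw [Set.mem_pow] at hy
      obtain ⟨f, rfl⟩ := hy
      choose x hx using fun i => (f i).2
      refine ⟨PiTensorProduct.tprod k x, ?_⟩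
      rw [TensorPower.toTensorAlgebra_tprod, TensorAlgebra.tprod_apply]
      congr 2
      funext i
      exact hx i
  rw [component, LinearMap.range_comp, h, ι, LinearMap.range_comp, Submodule.map_pow]

theorem ι_mul_mem (v : V) {n : ℕ} {a : HomogeneousAlgebra R} (ha : a ∈ component R n) :
    ι R v * a ∈ component R (n + 1) := by
  rw [component_eq_pow] at ha ⊢
  rw [pow_succ']
  exact Submodule.mul_mem_mul (LinearMap.mem_range_self _ v) ha

theorem one_mem_component : (1 : HomogeneousAlgebra R) ∈ component R 0 := by
  rw [component_eq_pow, pow_zero]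
  exact Submodule.one_le.1 le_rfl

/-- The orthogonal `R^⊥ ⊆ (V^*)^{⊗N}`, for the pairing with
`⟨α₁ ⊗ ⋯ ⊗ α_N, v₁ ⊗ ⋯ ⊗ v_N⟩ = α₁(v₁) ⋯ α_N(v_N)`. -/
def perp : Submodule k (⨂[k]^N (Module.Dual k V)) where
  carrier := {u | ∀ r ∈ R, TensorPower.pairingDual k V N u r = 0}
  add_mem' := by
    intro u u' hu hu' r hr
    rw [map_add, LinearMap.add_apply, hu r hr, hu' r hr, add_zero]
  zero_mem' := by
    intro r _
    rw [map_zero, LinearMap.zero_apply]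
  smul_mem' := by
    intro c u hu r hr
    rw [map_smul, LinearMap.smul_apply, hu r hr, smul_zero]

/-- The dual `N`-homogeneous algebra `A^!`, on `V^*` with space of relations `R^⊥`. -/
abbrev Shriek : Type (max u v) := HomogeneousAlgebra (perp R)

/-- The homogeneous component `A^!_n`. -/
abbrev shriekComponent (n : ℕ) : Submodule k (Shriek R) := component (perp R) n

/-- The jump map: `n(2q) = qN`, `n(2q + 1) = qN + 1`. -/
def jump (N : ℕ) : ℕ → ℕ
  | 0 => 0
  | i + 1 => jump N i + if Even i then 1 else N - 1

theorem jump_even_odd (hN : 1 ≤ N) (q : ℕ) :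
    jump N (2 * q) = q * N ∧ jump N (2 * q + 1) = q * N + 1 := by
  induction q with
  | zero => simp [jump]
  | succ q ih =>
    have h1 : jump N (2 * (q + 1)) = (q + 1) * N := by
      have : jump N (2 * (q + 1)) = jump N (2 * q + 1) + (N - 1) := by
        rw [show 2 * (q + 1) = 2 * q + 1 + 1 by ring, jump, if_neg (by simp)]
      rw [this, ih.2, add_mul]
      omega
    refine ⟨h1, ?_⟩
    rw [jump, h1, if_pos (by simp)]

section Trivial

variable [hN : Fact (2 ≤ N)]

/-- The augmentation `ε : A → k`, the algebra morphism that vanishes on `V`. -/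
def ε : HomogeneousAlgebra R →ₐ[k] k :=
  RingQuot.liftAlgHom k ⟨TensorAlgebra.algebraMapInv, by
    rintro _ _ ⟨⟨r, -, rfl⟩, rfl⟩
    rw [map_zero]
    have h : (TensorAlgebra.algebraMapInv (R := k) (M := V)).toLinearMap ∘ₗ
        TensorPower.toTensorAlgebra (n := N) = 0 := by
      apply PiTensorProduct.ext
      ext x
      obtain ⟨n, rfl⟩ : ∃ n, N = n + 1 := ⟨N - 1, by have := hN.out; omega⟩
      simp [TensorAlgebra.tprod_apply, List.ofFn_succ, TensorAlgebra.algebraMapInv]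
    exact LinearMap.congr_fun h r⟩

@[simp]
theorem ε_ι (v : V) : ε R (ι R v) = 0 := by
  change RingQuot.liftAlgHom k _ (RingQuot.mkAlgHom k _ _) = 0
  rw [RingQuot.liftAlgHom_mkAlgHom_apply]
  simp [TensorAlgebra.algebraMapInv]

/-- The trivial left module `k` over `A`, on which `a ∈ A` acts as the scalar `ε a`. -/
def Trivial (_ : Submodule k (⨂[k]^N V)) : Type u := k

instance : AddCommGroup (Trivial R) := inferInstanceAs (AddCommGroup k)

instance : Module k (Trivial R) := inferInstanceAs (Module k k)

instance : Module (HomogeneousAlgebra R) (Trivial R) :=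
  Module.compHom (Trivial R) (ε R).toRingHom

theorem smul_trivial (a : HomogeneousAlgebra R) (x : Trivial R) : a • x = ε R a • x := rfl

instance : SMulCommClass (HomogeneousAlgebra R) k (Trivial R) :=
  ⟨fun a c x => by rw [smul_trivial, smul_trivial, smul_comm]⟩

instance : IsScalarTower k (HomogeneousAlgebra R) (Trivial R) :=
  ⟨fun c a x => by rw [smul_trivial, smul_trivial, map_smul, smul_assoc]⟩

instance : SMulCommClass k (HomogeneousAlgebra R) (Trivial R) :=
  SMulCommClass.symm _ _ _

/-- The identity map from `k` to the trivial module. -/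
def toTrivial : k ≃ₗ[k] Trivial R := LinearEquiv.refl k k

end Trivial

/-! ### Graded resolutions, Tor and the Koszul property -/

section Tor

variable [Fact (2 ≤ N)]

/-- A projective resolution of the trivial module `k` in the category of graded left `A`-modules
with morphisms of degree `0` (a graded module is projective in this category if and only if the
underlying module is projective). The trivial module lives in degree `0`. -/
structure GradedResolution extends
    AugmentedSequence.{max u v, u, max u v} (HomogeneousAlgebra R) (Trivial R) where
  isProjectiveResolution : toAugmentedSequence.IsProjectiveResolution
  /-- the homogeneous component of degree `m` of `X i` -/
  deg : ∀ i : ℕ, ℤ → AddSubgroup (X i)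
  isInternal : ∀ i, DirectSum.IsInternal (deg i)
  smul_mem : ∀ (i n : ℕ) (m : ℤ) (a : HomogeneousAlgebra R) (x : X i),
    a ∈ component R n → x ∈ deg i m → a • x ∈ deg i (n + m)
  d_mem : ∀ (i : ℕ) (m : ℤ) (x : X (i + 1)), x ∈ deg (i + 1) m → d i x ∈ deg i m
  aug_eq_zero : ∀ (m : ℤ) (x : X 0), x ∈ deg 0 m → m ≠ 0 → aug x = 0

namespace GradedResolution

variable {R} (P : GradedResolution R)

/-- The submodule `A₊ P_i`, where `A₊ = ker ε`. The vector space `k ⊗_A P_i` is the quotient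
`P_i / A₊ P_i`. -/
def augMul (i : ℕ) : Submodule (HomogeneousAlgebra R) (P.X i) :=
  Submodule.span _ {y | ∃ (a : HomogeneousAlgebra R) (x : P.X i), ε R a = 0 ∧ y = a • x}

/-- The homogeneous elements of degree `m` of `P_i` that represent cycles of `k ⊗_A P`. -/
def torCycles : ∀ (i : ℕ) (_ : ℤ), AddSubgroup (P.X i)
  | 0, m => P.deg 0 m
  | i + 1, m => P.deg (i + 1) m ⊓ ((P.augMul i).comap (P.d i)).toAddSubgroup

/-- The elements of `P_i` that represent boundaries of `k ⊗_A P`. -/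
def torBoundaries (i : ℕ) : AddSubgroup (P.X i) :=
  (LinearMap.range (P.d i) ⊔ P.augMul i).toAddSubgroup

/-- The component of degree `m` of the graded vector space `Tor_i^A(k, k) = H_i(k ⊗_A P)`. -/
abbrev Tor (i : ℕ) (m : ℤ) : Type _ :=
  P.torCycles i m ⧸ (P.torBoundaries i).addSubgroupOf (P.torCycles i m)

end GradedResolution

/-- `A` is (generalized) Koszul: for `i ≥ 3`, the graded vector space `Tor_i^A(k, k)`, computed
with a graded projective resolution of `k`, is concentrated in degree `n(i)`. -/
def IsKoszul : Prop :=
  ∃ P : GradedResolution R, ∀ i : ℕ, 3 ≤ i → ∀ m : ℤ, m ≠ jump N i → Subsingleton (P.Tor i m)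

end Tor

/-! ### The Koszul complex -/

section Koszul

/-- The term `A ⊗ (A^!_m)^*` of the left Koszul `N`-complex. -/
abbrev KTerm (m : ℕ) : Type (max u v) :=
  HomogeneousAlgebra R ⊗[k] Module.Dual k (shriekComponent R m)

/-- Left multiplication by `θ ∈ V^*`, as a map `A^!_m → A^!_{m+1}`. -/
def mulLeft (θ : Module.Dual k V) (m : ℕ) : shriekComponent R m →ₗ[k] shriekComponent R (m + 1) :=
  (LinearMap.mulLeft k (ι (perp R) θ)).restrict fun _ ha => ι_mul_mem (perp R) θ ha

section Differential

variable [FiniteDimensional k V]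

/-- The differential `d (a ⊗ α) = ∑_l a e_l ⊗ α·e_l^*` of the left Koszul `N`-complex, for a
basis `(e_l)` of `V`, where `⟨α·e_l^*, f⟩ = ⟨α, e_l^* f⟩`. -/
def kd (m : ℕ) : KTerm R (m + 1) →ₗ[HomogeneousAlgebra R] KTerm R m :=
  ∑ l, TensorProduct.AlgebraTensorModule.map
    (LinearMap.toSpanSingleton (HomogeneousAlgebra R) (HomogeneousAlgebra R)
      (ι R (Module.finBasis k V l)))
    (mulLeft R ((Module.finBasis k V).coord l) m).dualMap

theorem kd_tmul (m : ℕ) (a : HomogeneousAlgebra R) (α : Module.Dual k (shriekComponent R (m + 1))) :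
    kd R m (a ⊗ₜ α) = ∑ l, (a * ι R (Module.finBasis k V l)) ⊗ₜ[k]
      (α ∘ₗ mulLeft R ((Module.finBasis k V).coord l) m) := by
  rw [kd, LinearMap.sum_apply]
  rfl

/-- The `p`-fold iterate of the differential. -/
def kdIter (m : ℕ) : ∀ p : ℕ, KTerm R (m + p) →ₗ[HomogeneousAlgebra R] KTerm R m
  | 0 => LinearMap.id
  | p + 1 => kdIter m p ∘ₗ kd R (m + p)

end Differential

variable [Fact (2 ≤ N)]

/-- The map `A ⊗ (A^!_m)^* → k`, `a ⊗ α ↦ ε(a) ⟨α, f⟩`, attached to `f ∈ A^!_m`. -/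
def kEval (m : ℕ) (f : shriekComponent R m) : KTerm R m →ₗ[HomogeneousAlgebra R] Trivial R :=
  TensorProduct.AlgebraTensorModule.lift
    (LinearMap.toSpanSingleton (HomogeneousAlgebra R)
      (Module.Dual k (shriekComponent R m) →ₗ[k] Trivial R)
      ((toTrivial R).toLinearMap ∘ₗ Module.Dual.eval k (shriekComponent R m) f))

theorem kEval_tmul (m : ℕ) (f : shriekComponent R m) (a : HomogeneousAlgebra R)
    (α : Module.Dual k (shriekComponent R m)) :
    kEval R m f (a ⊗ₜ α) = toTrivial R (ε R a * α f) := rfl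

theorem kEval_add (m : ℕ) (f g : shriekComponent R m) :
    kEval R m (f + g) = kEval R m f + kEval R m g := by
  apply LinearMap.restrictScalars_injective k
  apply TensorProduct.ext'
  intro a α
  change kEval R m (f + g) (a ⊗ₜ α) = kEval R m f (a ⊗ₜ α) + kEval R m g (a ⊗ₜ α)
  rw [kEval_tmul, kEval_tmul, kEval_tmul, α.map_add, mul_add, (toTrivial R).map_add]

theorem kEval_smul (m : ℕ) (c : k) (f : shriekComponent R m) :
    kEval R m (c • f) = c • kEval R m f := by
  apply LinearMap.restrictScalars_injective k
  apply TensorProduct.ext'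
  intro a α
  change kEval R m (c • f) (a ⊗ₜ α) = c • kEval R m f (a ⊗ₜ α)
  rw [kEval_tmul, kEval_tmul, α.map_smul, ← (toTrivial R).map_smul, mul_smul_comm]

variable [FiniteDimensional k V]

theorem kEval_comp_kd (m : ℕ) (f : shriekComponent R m) : kEval R m f ∘ₗ kd R m = 0 := by
  apply LinearMap.restrictScalars_injective k
  apply TensorProduct.ext'
  intro a α
  change kEval R m f (kd R m (a ⊗ₜ α)) = 0
  rw [kd_tmul, map_sum]
  refine Finset.sum_eq_zero fun l _ => ?_
  rw [kEval_tmul, map_mul (ε R), ε_ι, mul_zero, zero_mul, (toTrivial R).map_zero]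

theorem kEval_comp_kdIter (m p : ℕ) (f : shriekComponent R m) :
    kEval R m f ∘ₗ kdIter R m (p + 1) = 0 := by
  induction p with
  | zero => exact kEval_comp_kd R m f
  | succ p ih => rw [kdIter, ← LinearMap.comp_assoc, ih, LinearMap.zero_comp]

/-- The Koszul complex `⋯ → A ⊗ (A^!_{n(2)})^* → A ⊗ (A^!_{n(1)})^* → A ⊗ (A^!_{n(0)})^* → k`:
the contraction of the left Koszul `N`-complex whose differentials are alternately `d` and
`d^{N-1}`, with the usual augmentation `a ⊗ α ↦ ε(a) ⟨α, 1⟩`. -/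
def koszulComplex :
    AugmentedSequence.{max u v, u, max u v} (HomogeneousAlgebra R) (Trivial R) where
  X i := KTerm R (jump N i)
  d i := kdIter R (jump N i) (if Even i then 1 else N - 1)
  aug := kEval R 0 ⟨1, one_mem_component (perp R)⟩

/-- The Yoneda algebra `E(A)_i = Ext_A^i(k, k)`, computed with the Koszul complex. -/
abbrev E (i : ℕ) : Type _ := (koszulComplex R).Ext k i

/-- The identification `A^!_{n(i)} → E(A)_i`, sending `f` to the class of the cocycle
`a ⊗ α ↦ ε(a) ⟨α, f⟩` of `Hom_A(P, k)`. -/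
def toE (i : ℕ) : shriekComponent R (jump N i) →ₗ[k] E R i :=
  (koszulComplex R).extMk k i ∘ₗ
    { toFun := fun f => ⟨kEval R (jump N i) f, by
        change kEval R (jump N i) f ∘ₗ kdIter R (jump N i) (if Even i then 1 else N - 1) = 0
        obtain ⟨p, hp⟩ : ∃ p, (if Even i then 1 else N - 1) = p + 1 :=
          Nat.exists_eq_succ_of_ne_zero (by
            have := (inferInstance : Fact (2 ≤ N)).out
            split_ifs <;> omega)
        rw [hp]
        exact kEval_comp_kdIter R _ p f⟩
      map_add' := by
        intro f g
        exact Subtype.ext (kEval_add R _ f g)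
      map_smul' := by
        intro c f
        exact Subtype.ext (kEval_smul R _ c f) }

end Koszul

end HomogeneousAlgebra

end

/-! The resolution. By finite-dimensionality, `A ⊗ (A^!_m)^*` is the space of linear maps `φ : A^! →
A` supported in degree `m`, and the differential becomes `(dφ)(f) = ∑ φ(e_l^* f) e_l` (`toHom_kd`).
Its powers are sums over words (`kdHom_pow_apply`), and `R^⊥⊥ = R` gives `d^N = 0`. Exactness of `P`
at `P_0` and `P_1` holds for every homogeneous algebra: it says that `A` is generated by `V` with
relations `R`. Further up, `P` is compared with a graded resolution `Q` computing Tor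
(`HasComparison`). Write `Z_i` for the syzygies of `P_i` and `A₊` for the kernel of `ε`. If `P` is
exact below `P_i`, vanishing of the degree `s + n(i)` part of `Tor_{i+1}` forces a syzygy in `P_i`
with values in `A_s` to lie in `A₊ Z_i` (`mem_augSyz`). By induction on `s` (graded Nakayama), only
syzygies with values in `A_s`, `s = n(i+1) - n(i)`, need a preimage (`syz_le_range_of_homogeneous`).
There `s < N`, so `A_s = V^{⊗s}`, and a preimage must send `uv`, with `u` a word of length `s`, to
the coordinate of `φ(v)` at `u`. Relations of `A^!` inside `v` are respected because `φ` is defined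
on `A^!`, those at the very beginning because `φ` is a syzygy. For `s = 1` nothing else occurs; for
`s = N - 1` those in between are handled by Berger's extra condition on `R`, which itself follows
from exactness at `P_2` (`extraCondition_of_exact`). The product. The differential multiplies on the
left in `A^!`, hence commutes with precomposition by right multiplication by `g`. So `g̃_l =
(-1)^{jl} d^c (· g)` with `c = n(l+j) - n(l) - n(j)` lifts the cocycle `g` (`exists_isLift`). At `l
= i`, the exponent `c` is `N - 2` if `i` and `j` are both odd and `0` otherwise. If `c = 0`,
composing with `f` evaluates at `(-1)^{ij} fg`; if `c > 0`, the values of `g̃_i` lie in `A₊` and `ε`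
kills them. No class is lost, because `P` is minimal: the differential of `Hom_A(P, k)` is zero
(`toE_bijective`). -/

noncomputable section

/-! ### Sums over words. -/

/-- The words of length `n` in the alphabet `κ`. -/
def words (κ : Type*) [Fintype κ] (n : ℕ) : Finset (List κ) :=
  Finset.univ.map ⟨fun z : Fin n → κ => List.ofFn z, List.ofFn_injective⟩

section WordSums

variable {κ : Type*} [Fintype κ]

@[simp]
theorem mem_words {n : ℕ} {L : List κ} : L ∈ words κ n ↔ L.length = n := by
  constructor
  · intro h
    obtain ⟨z, -, rfl⟩ := Finset.mem_map.1 h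
    exact List.length_ofFn
  · rintro rfl
    exact Finset.mem_map.2 ⟨L.get, Finset.mem_univ _, List.ofFn_get L⟩

theorem sum_words {Y : Type*} [AddCommMonoid Y] (n : ℕ) (F : List κ → Y) :
    ∑ L ∈ words κ n, F L = ∑ z : Fin n → κ, F (List.ofFn z) :=
  Finset.sum_map _ _ _

theorem sum_words_add {Y : Type*} [AddCommMonoid Y] (p q : ℕ) (F : List κ → Y) :
    ∑ L ∈ words κ (p + q), F L = ∑ u ∈ words κ p, ∑ w ∈ words κ q, F (u ++ w) := by
  rw [← Finset.sum_product']
  symm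
  refine Finset.sum_bij' (fun x _ => x.1 ++ x.2) (fun L _ => (L.take p, L.drop p)) ?_ ?_ ?_ ?_ ?_
  · intro x hx
    simp only [Finset.mem_product, mem_words] at hx ⊢
    simp [hx.1, hx.2]
  · intro L hL
    simp only [Finset.mem_product, mem_words] at hL ⊢
    simp [hL]
  · intro x hx
    simp only [Finset.mem_product, mem_words] at hx
    simp [← hx.1]
  · intro L _
    simp
  · intro x _
    rfl

theorem sum_words_zero {Y : Type*} [AddCommMonoid Y] (F : List κ → Y) :
    ∑ L ∈ words κ 0, F L = F [] := by
  rw [sum_words]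
  simp

theorem sum_words_one {Y : Type*} [AddCommMonoid Y] (F : List κ → Y) :
    ∑ L ∈ words κ 1, F L = ∑ l, F [l] := by
  rw [sum_words]
  exact Fintype.sum_equiv (Equiv.funUnique (Fin 1) κ) _ _ fun z => by simp

end WordSums

namespace HomogeneousAlgebra

/-! ### Words in a homogeneous algebra, and linear maps prescribed on words. -/

section Words

variable {k : Type u} [Field k] {U : Type v} [AddCommGroup U] [Module k U] {N : ℕ}
  (S : Submodule k (⨂[k]^N U)) {κ : Type w} (b : Module.Basis κ k U)

/-- The product of the generators `b l`, for `l` in a word. -/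
def word (L : List κ) : HomogeneousAlgebra S := (L.map fun l => ι S (b l)).prod

@[simp]
theorem word_nil : word S b [] = 1 := rfl

theorem word_cons (l : κ) (L : List κ) : word S b (l :: L) = ι S (b l) * word S b L := by
  simp [word]

theorem word_append (L M : List κ) : word S b (L ++ M) = word S b L * word S b M := by
  simp [word]

theorem word_singleton (l : κ) : word S b [l] = ι S (b l) := by
  simp [word]

theorem mk_word (L : List κ) :
    mk S ((L.map fun l => TensorAlgebra.ι k (b l)).prod) = word S b L := by
  rw [word, map_list_prod, List.map_map]
  rfl

theorem mk_surjective : Function.Surjective (mk S) := RingQuot.mkAlgHom_surjective k _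

theorem tensorAlgebra_basis_apply (L : FreeMonoid κ) :
    b.tensorAlgebra L = ((FreeMonoid.toList L).map fun l => TensorAlgebra.ι k (b l)).prod := by
  rw [Module.Basis.tensorAlgebra, Module.Basis.map_apply]
  change (TensorAlgebra.equivFreeAlgebra b).symm _ = _
  have h : FreeAlgebra.basisFreeMonoid k κ L =
      ((FreeMonoid.toList L).map (FreeAlgebra.ι k)).prod := by
    simp [FreeAlgebra.basisFreeMonoid, FreeAlgebra.equivMonoidAlgebraFreeMonoid,
      FreeMonoid.lift_apply]
  rw [h, map_list_prod, List.map_map]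
  congr 2
  funext l
  exact TensorAlgebra.equivFreeAlgebra_symm_ι b l

theorem span_word : Submodule.span k (Set.range (word S b)) = ⊤ := by
  have h := b.tensorAlgebra.span_eq
  have h2 := congrArg (Submodule.map (mk S).toLinearMap) h
  rw [Submodule.map_span, Submodule.map_top,
    LinearMap.range_eq_top.2 (mk_surjective S), ← Set.range_comp] at h2
  rw [← h2]
  congr 2
  funext L
  change word S b L = mk S (b.tensorAlgebra (FreeMonoid.ofList L))
  rw [tensorAlgebra_basis_apply, ← mk_word]
  rfl

variable {S} in
theorem ext_word {Y : Type*} [AddCommMonoid Y] [Module k Y]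
    {F G : HomogeneousAlgebra S →ₗ[k] Y} (h : ∀ L, F (word S b L) = G (word S b L)) : F = G :=
  LinearMap.ext_on_range (span_word S b) h

variable {S} in
@[elab_as_elim]
theorem word_induction {p : HomogeneousAlgebra S → Prop} (a : HomogeneousAlgebra S)
    (word : ∀ L, p (word S b L)) (add : ∀ x y, p x → p y → p (x + y)) (zero : p 0)
    (smul : ∀ (c : k) x, p x → p (c • x)) : p a := by
  have h : a ∈ Submodule.span k (Set.range (HomogeneousAlgebra.word S b)) := by
    rw [span_word]
    trivial
  refine Submodule.span_induction ?_ zero (fun x y _ _ => add x y) (fun c x _ => smul c x) h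
  rintro _ ⟨L, rfl⟩
  exact word L

theorem mk_toTensorAlgebra_eq_zero {r : ⨂[k]^N U} (hr : r ∈ S) :
    mk S (TensorPower.toTensorAlgebra r) = 0 := by
  rw [← map_zero (mk S)]
  exact RingQuot.mkAlgHom_rel k ⟨⟨r, hr, rfl⟩, rfl⟩

section Lift

variable {Y : Type*} [AddCommGroup Y] [Module k Y]

/-- The linear maps on the tensor algebra that vanish on the ideal of relations. -/
def relVanishing (S : Submodule k (⨂[k]^N U)) (Y : Type*) [AddCommGroup Y] [Module k Y] :
    Submodule k (TensorAlgebra k U →ₗ[k] Y) where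
  carrier := {F | ∀ r ∈ S, ∀ x y, F (x * TensorPower.toTensorAlgebra r * y) = 0}
  add_mem' := by
    intro F G hF hG r hr x y
    rw [LinearMap.add_apply, hF r hr, hG r hr, add_zero]
  zero_mem' := fun _ _ _ _ => rfl
  smul_mem' := by
    intro c F hF r hr x y
    rw [LinearMap.smul_apply, hF r hr, smul_zero]

/-- Right translation by elements of the tensor algebra. -/
def translate (S : Submodule k (⨂[k]^N U)) (Y : Type*) [AddCommGroup Y] [Module k Y] :
    TensorAlgebra k U →ₐ[k] Module.End k (relVanishing S Y) :=
  AlgHom.ofLinearMap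
    { toFun := fun t =>
        { toFun := fun F => ⟨F.1 ∘ₗ LinearMap.mulRight k t, by
            intro r hr x y
            simpa [mul_assoc] using F.2 r hr x (y * t)⟩
          map_add' := fun _ _ => rfl
          map_smul' := fun _ _ => rfl }
      map_add' := by
        intro t s
        ext F x
        simp [mul_add]
      map_smul' := by
        intro c t
        ext F x
        simp }
    (by ext F x; simp)
    (by
      intro t s
      ext F x
      simp [mul_assoc])

theorem translate_apply (t : TensorAlgebra k U) (F : relVanishing S Y) (x : TensorAlgebra k U) :
    (translate S Y t F).1 x = F.1 (x * t) := rfl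

/-- The universal property of `RingQuot` concerns algebra morphisms only. Right translation turns
the space of linear maps vanishing on the ideal into a module over the tensor algebra, on which the
relations act as zero; hence `A` acts. Letting `a` act on `F` and evaluating at `1` gives the
factorization. -/
theorem exists_factor (F : TensorAlgebra k U →ₗ[k] Y) (hF : F ∈ relVanishing S Y) :
    ∃ G : HomogeneousAlgebra S →ₗ[k] Y, ∀ t, G (mk S t) = F t := by
  let T : HomogeneousAlgebra S →ₐ[k] Module.End k (relVanishing S Y) :=
    RingQuot.liftAlgHom k ⟨translate S Y, by
      rintro _ _ ⟨⟨r, hr, rfl⟩, rfl⟩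
      rw [map_zero]
      ext G x
      rw [translate_apply]
      simpa using G.2 r hr x 1⟩
  have hT : ∀ t, T (mk S t) = translate S Y t := fun t =>
    RingQuot.liftAlgHom_mkAlgHom_apply k _ _ _
  refine ⟨{ toFun := fun a => (T a ⟨F, hF⟩).1 1, map_add' := ?_, map_smul' := ?_ }, ?_⟩
  · intro x y
    rw [map_add]
    rfl
  · intro c x
    rw [map_smul]
    rfl
  · intro t
    change (T (mk S t) ⟨F, hF⟩).1 1 = F t
    rw [hT, translate_apply, one_mul]

end Lift

theorem tensorPower_hom_ext {n : ℕ} {Y : Type*} [AddCommGroup Y] [Module k Y]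
    {F G : ⨂[k]^n U →ₗ[k] Y}
    (h : ∀ z : Fin n → κ, F (PiTensorProduct.tprod k fun i => b (z i)) =
      G (PiTensorProduct.tprod k fun i => b (z i))) : F = G :=
  PiTensorProduct.ext (Module.Basis.ext_multilinear (fun _ => b) h)

theorem pairingDual_coord_tprod {n : ℕ} (z z' : Fin n → κ) [DecidableEq κ] :
    TensorPower.pairingDual k U n (PiTensorProduct.tprod k fun i => b.coord (z i))
      (PiTensorProduct.tprod k fun i => b (z' i)) = if z = z' then 1 else 0 := by
  rw [TensorPower.pairingDual_tprod_tprod]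
  simp only [Module.Basis.coord_apply, Module.Basis.repr_self]
  split_ifs with h
  · subst h
    simp
  · obtain ⟨i, hi⟩ := Function.ne_iff.1 h
    exact Finset.prod_eq_zero (Finset.mem_univ i) (by simp [Ne.symm hi])

section Fintype

variable [Fintype κ]

/-- `c`, as a function on words of length `N`, is the family of coordinates of an element
of the space of relations. -/
def IsRel (c : List κ → k) : Prop :=
  ∑ z : Fin N → κ, c (List.ofFn z) • PiTensorProduct.tprod k (fun i => b (z i)) ∈ S

theorem eq_sum_tprod {n : ℕ} (r : ⨂[k]^n U) :
    r = ∑ z : Fin n → κ, TensorPower.pairingDual k U n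
      (PiTensorProduct.tprod k fun i => b.coord (z i)) r •
        PiTensorProduct.tprod k fun i => b (z i) := by
  classical
  have h : LinearMap.id = ∑ z : Fin n → κ, (TensorPower.pairingDual k U n
      (PiTensorProduct.tprod k fun i => b.coord (z i))).smulRight
        (PiTensorProduct.tprod k fun i => b (z i)) := by
    apply tensorPower_hom_ext b
    intro z
    simp only [LinearMap.id_apply, LinearMap.sum_apply, LinearMap.smulRight_apply,
      pairingDual_coord_tprod, ite_smul, one_smul, zero_smul, Finset.sum_ite_eq',
      Finset.mem_univ, if_true]
  simpa using LinearMap.congr_fun h r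

theorem exists_coords {r : ⨂[k]^N U} (hr : r ∈ S) : ∃ c : List κ → k, IsRel S b c ∧
    r = ∑ z : Fin N → κ, c (List.ofFn z) • PiTensorProduct.tprod k (fun i => b (z i)) := by
  classical
  let c : List κ → k := fun L => if h : L.length = N then
    TensorPower.pairingDual k U N
      (PiTensorProduct.tprod k fun i => b.coord (L.get (i.cast h.symm))) r else 0
  have hc : r = ∑ z : Fin N → κ, c (List.ofFn z) • PiTensorProduct.tprod k (fun i => b (z i)) := by
    conv_lhs => rw [eq_sum_tprod b r]
    refine Finset.sum_congr rfl fun z _ => ?_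
    simp [c]
  exact ⟨c, by rw [IsRel, ← hc]; exact hr, hc⟩

theorem toTensorAlgebra_sum (c : List κ → k) :
    TensorPower.toTensorAlgebra
        (∑ z : Fin N → κ, c (List.ofFn z) • PiTensorProduct.tprod k (fun i => b (z i))) =
      ∑ z ∈ words κ N, c z • (z.map fun l => TensorAlgebra.ι k (b l)).prod := by
  rw [map_sum, sum_words]
  refine Finset.sum_congr rfl fun z _ => ?_
  rw [map_smul, TensorPower.toTensorAlgebra_tprod, TensorAlgebra.tprod_apply, List.map_ofFn]
  rfl

theorem sum_smul_word_eq_zero {c : List κ → k} (hc : IsRel S b c) :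
    ∑ z ∈ words κ N, c z • word S b z = 0 := by
  have h := mk_toTensorAlgebra_eq_zero S hc
  rw [toTensorAlgebra_sum, map_sum] at h
  simpa only [map_smul, mk_word] using h

/-- Words form a basis of the tensor algebra, and the ideal of relations is spanned by the products
of a word, a relation and a word. This is the way in which all linear maps out of `A` and `A^!` are
constructed below. -/
theorem exists_linearMap {Y : Type*} [AddCommGroup Y] [Module k Y] (c : List κ → Y)
    (hc : ∀ r : List κ → k, IsRel S b r → ∀ x y : List κ,
      ∑ z ∈ words κ N, r z • c (x ++ z ++ y) = 0) :
    ∃ F : HomogeneousAlgebra S →ₗ[k] Y, ∀ L, F (word S b L) = c L := by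
  let F : TensorAlgebra k U →ₗ[k] Y := b.tensorAlgebra.constr k fun L => c (FreeMonoid.toList L)
  have hF : ∀ L : List κ, F ((L.map fun l => TensorAlgebra.ι k (b l)).prod) = c L := by
    intro L
    have h := b.tensorAlgebra.constr_basis k (fun L => c (FreeMonoid.toList L))
      (FreeMonoid.ofList L)
    rwa [tensorAlgebra_basis_apply] at h
  have hF0 : F ∈ relVanishing S Y := by
    intro r hr x y
    obtain ⟨a, ha, rfl⟩ := exists_coords S b hr
    rw [toTensorAlgebra_sum]
    set ρ := ∑ z ∈ words κ N, a z • (z.map fun l => TensorAlgebra.ι k (b l)).prod with hρ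
    have key : (LinearMap.compr₂ (LinearMap.mul k _ ∘ₗ LinearMap.mulRight k ρ) F) = 0 := by
      apply b.tensorAlgebra.ext
      intro L
      apply b.tensorAlgebra.ext
      intro M
      rw [tensorAlgebra_basis_apply, tensorAlgebra_basis_apply]
      simp only [LinearMap.compr₂_apply, LinearMap.comp_apply, LinearMap.mulRight_apply,
        LinearMap.mul_apply', LinearMap.zero_apply]
      rw [hρ, Finset.mul_sum, Finset.sum_mul, map_sum]
      rw [← hc a ha (FreeMonoid.toList L) (FreeMonoid.toList M)]
      refine Finset.sum_congr rfl fun z _ => ?_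
      rw [mul_smul_comm, smul_mul_assoc, map_smul, ← List.prod_append, ← List.prod_append,
        ← List.map_append, ← List.map_append, hF]
    exact LinearMap.congr_fun (LinearMap.congr_fun key x) y
  obtain ⟨G, hG⟩ := exists_factor S F hF0
  exact ⟨G, fun L => by rw [← mk_word, hG, hF]⟩

end Fintype

end Words

/-! ### The grading, coordinates in degrees below `N`, and the augmentation. -/

section Grading

variable {k : Type u} [Field k] {U : Type v} [AddCommGroup U] [Module k U] {N : ℕ}
  (S : Submodule k (⨂[k]^N U)) {κ : Type w} [Fintype κ] (b : Module.Basis κ k U)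

/-- Relations are homogeneous, so a function on words of length `n`, extended by zero, meets only
the relations inside words of that length. For `n < N` there is no condition at all. -/
theorem exists_linearMap_of_length {Y : Type*} [AddCommGroup Y] [Module k Y] (n : ℕ)
    (c : List κ → Y)
    (hc : ∀ r : List κ → k, IsRel S b r → ∀ x y : List κ, x.length + N + y.length = n →
      ∑ z ∈ words κ N, r z • c (x ++ z ++ y) = 0) :
    ∃ F : HomogeneousAlgebra S →ₗ[k] Y, ∀ L, F (word S b L) = if L.length = n then c L else 0 := by
  refine exists_linearMap S b (fun L => if L.length = n then c L else 0) ?_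
  intro r hr x y
  by_cases h : x.length + N + y.length = n
  · rw [← hc r hr x y h]
    refine Finset.sum_congr rfl fun z hz => ?_
    rw [mem_words] at hz
    rw [if_pos (by simp [hz]; omega)]
  · refine Finset.sum_eq_zero fun z hz => ?_
    rw [mem_words] at hz
    rw [if_neg (by simp [hz]; omega), smul_zero]

theorem exists_proj (n : ℕ) : ∃ F : HomogeneousAlgebra S →ₗ[k] HomogeneousAlgebra S,
    ∀ L, F (word S b L) = if L.length = n then word S b L else 0 := by
  refine exists_linearMap_of_length S b n (word S b) ?_
  intro r hr x y _
  have h : ∑ z ∈ words κ N, r z • word S b (x ++ z ++ y) =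
      word S b x * (∑ z ∈ words κ N, r z • word S b z) * word S b y := by
    rw [Finset.mul_sum, Finset.sum_mul]
    refine Finset.sum_congr rfl fun z _ => ?_
    rw [word_append, word_append, mul_smul_comm, smul_mul_assoc]
  rw [h, sum_smul_word_eq_zero S b hr, mul_zero, zero_mul]

/-- The projection to the homogeneous component of degree `n`. -/
def proj (n : ℕ) : HomogeneousAlgebra S →ₗ[k] HomogeneousAlgebra S := (exists_proj S b n).choose

theorem proj_word (n : ℕ) (L : List κ) :
    proj S b n (word S b L) = if L.length = n then word S b L else 0 :=
  (exists_proj S b n).choose_spec L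

variable {S}

omit [Fintype κ] in
theorem mul_mem_component {p q : ℕ} {x y : HomogeneousAlgebra S} (hx : x ∈ component S p)
    (hy : y ∈ component S q) : x * y ∈ component S (p + q) := by
  rw [component_eq_pow] at *
  rw [pow_add]
  exact Submodule.mul_mem_mul hx hy

omit [Fintype κ] in
theorem word_mem_component (L : List κ) : word S b L ∈ component S L.length := by
  induction L with
  | nil => exact one_mem_component S
  | cons l L ih =>
    rw [word_cons]
    exact ι_mul_mem S (b l) ih

theorem component_eq_span (n : ℕ) :
    component S n = Submodule.span k (word S b '' (words κ n : Set (List κ))) := by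
  apply le_antisymm
  · rw [component, LinearMap.range_le_iff_comap, ← top_le_iff]
    rintro t -
    rw [Submodule.mem_comap, eq_sum_tprod b t, map_sum]
    refine Submodule.sum_mem _ fun z _ => ?_
    rw [map_smul]
    refine Submodule.smul_mem _ _ (Submodule.subset_span ⟨List.ofFn z, ?_, ?_⟩)
    · simp
    · rw [LinearMap.comp_apply, TensorPower.toTensorAlgebra_tprod, TensorAlgebra.tprod_apply,
        ← mk_word, List.map_ofFn]
      rfl
  · rw [Submodule.span_le]
    rintro _ ⟨L, hL, rfl⟩
    have hL' : L.length = n := mem_words.1 hL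
    rw [← hL']
    exact word_mem_component b L

theorem proj_of_mem {n : ℕ} {a : HomogeneousAlgebra S} (ha : a ∈ component S n) (m : ℕ) :
    proj S b m a = if n = m then a else 0 := by
  rw [component_eq_span b] at ha
  refine Submodule.span_induction ?_ (by simp) ?_ ?_ ha
  · rintro _ ⟨L, hL, rfl⟩
    have hL' : L.length = n := mem_words.1 hL
    rw [proj_word, hL']
  · intro x y _ _ hx hy
    rw [map_add, hx, hy]
    split_ifs <;> simp
  · intro c x _ hx
    rw [map_smul, hx]
    split_ifs <;> simp

theorem proj_mem (n : ℕ) (a : HomogeneousAlgebra S) : proj S b n a ∈ component S n := by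
  induction a using word_induction b with
  | word L =>
    rw [proj_word]
    split_ifs with h
    · rw [← h]
      exact word_mem_component b L
    · exact zero_mem _
  | add x y hx hy =>
    rw [map_add]
    exact add_mem hx hy
  | zero =>
    rw [map_zero]
    exact zero_mem _
  | smul c x hx =>
    rw [map_smul]
    exact Submodule.smul_mem _ c hx

theorem proj_mul_of_mem {p : ℕ} {y : HomogeneousAlgebra S} (hy : y ∈ component S p) (s : ℕ)
    (x : HomogeneousAlgebra S) : proj S b (s + p) (x * y) = proj S b s x * y := by
  induction x using word_induction b with
  | word L =>
    rw [proj_of_mem b (mul_mem_component (word_mem_component b L) hy), proj_word]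
    by_cases h : L.length = s
    · rw [if_pos h, if_pos (by omega)]
    · rw [if_neg h, if_neg (by omega), zero_mul]
  | add x x' hx hx' => rw [add_mul, map_add, map_add, hx, hx', add_mul]
  | zero => simp
  | smul c x hx => rw [smul_mul_assoc, map_smul, map_smul, hx, smul_mul_assoc]

theorem proj_ι_mul (m : ℕ) (v : U) (x : HomogeneousAlgebra S) :
    proj S b (m + 1) (ι S v * x) = ι S v * proj S b m x := by
  induction x using word_induction b with
  | word L =>
    rw [proj_of_mem b (ι_mul_mem S v (word_mem_component b L)), proj_word]
    by_cases h : L.length = m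
    · rw [if_pos h, if_pos (by omega)]
    · rw [if_neg h, if_neg (by omega), mul_zero]
  | add x x' hx hx' => rw [mul_add, map_add, map_add, hx, hx', mul_add]
  | zero => simp
  | smul c x hx => rw [mul_smul_comm, map_smul, map_smul, hx, mul_smul_comm]

theorem proj_mul (s : ℕ) (x y : HomogeneousAlgebra S) :
    proj S b s (x * y) = ∑ pq ∈ Finset.HasAntidiagonal.antidiagonal s,
      proj S b pq.1 x * proj S b pq.2 y := by
  induction y using word_induction b with
  | word L =>
    by_cases h : L.length ≤ s
    · obtain ⟨p, rfl⟩ := Nat.exists_eq_add_of_le' h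
      rw [proj_mul_of_mem b (word_mem_component b L),
        Finset.sum_eq_single (p, L.length)]
      · rw [proj_word, if_pos rfl]
      · rintro ⟨p', q'⟩ hpq hne
        rw [Finset.HasAntidiagonal.mem_antidiagonal] at hpq
        rw [proj_word, if_neg, mul_zero]
        rintro rfl
        exact hne (by simp at hpq; simp [hpq])
      · intro hn
        exact absurd (by simp) hn
    · rw [Finset.sum_eq_zero]
      · induction x using word_induction b with
        | word M =>
          rw [← word_append, proj_word, if_neg]
          rw [List.length_append]
          omega
        | add x x' hx hx' => rw [add_mul, map_add, hx, hx', add_zero]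
        | zero => simp
        | smul c x hx => rw [smul_mul_assoc, map_smul, hx, smul_zero]
      · rintro ⟨p', q'⟩ hpq
        rw [Finset.HasAntidiagonal.mem_antidiagonal] at hpq
        rw [proj_word, if_neg, mul_zero]
        simp only at hpq
        omega
  | add x y hx hy => simp only [mul_add, map_add, hx, hy, Finset.sum_add_distrib]
  | zero => simp
  | smul c x hx => simp only [mul_smul_comm, map_smul, hx, Finset.smul_sum]

theorem exists_sum_proj (a : HomogeneousAlgebra S) :
    ∃ M, ∀ M', M ≤ M' → ∑ n ∈ Finset.range M', proj S b n a = a := by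
  induction a using word_induction b with
  | word L =>
    refine ⟨L.length + 1, fun M' h => ?_⟩
    simp only [proj_word]
    rw [Finset.sum_ite_eq, if_pos (by simp; omega)]
  | add x y hx hy =>
    obtain ⟨M₁, h₁⟩ := hx
    obtain ⟨M₂, h₂⟩ := hy
    refine ⟨max M₁ M₂, fun M' h => ?_⟩
    simp only [map_add, Finset.sum_add_distrib]
    rw [h₁ M' (le_trans (le_max_left _ _) h), h₂ M' (le_trans (le_max_right _ _) h)]
  | zero => exact ⟨0, fun _ _ => by simp⟩
  | smul c x hx =>
    obtain ⟨M, h⟩ := hx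
    refine ⟨M, fun M' hM => ?_⟩
    simp only [map_smul, ← Finset.smul_sum]
    rw [h M' hM]

section Small

-- No relation fits into a word shorter than `N`: below degree `N` the algebra is the tensor
-- algebra, and its words are independent. The length bound sits inside the existential so that
-- `wordCoord` makes sense for every word.
open Classical in
theorem exists_wordCoord (u : List κ) : ∃ F : HomogeneousAlgebra S →ₗ[k] k,
    u.length < N → ∀ L, F (word S b L) = if L = u then 1 else 0 := by
  by_cases h : u.length < N
  · obtain ⟨F, hF⟩ := exists_linearMap_of_length S b u.length
      (fun L => if L = u then (1 : k) else 0) (fun r _ x y hxy => by omega)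
    refine ⟨F, fun _ L => ?_⟩
    rw [hF]
    by_cases hL : L = u
    · rw [if_pos (by rw [hL])]
    · rw [if_neg hL, ite_self]
  · exact ⟨0, fun h' => absurd h' h⟩

/-- The coordinate along a word of length less than `N`. -/
def wordCoord (u : List κ) : HomogeneousAlgebra S →ₗ[k] k := (exists_wordCoord b u).choose

open Classical in
theorem wordCoord_word {u : List κ} (hu : u.length < N) (L : List κ) :
    wordCoord (S := S) b u (word S b L) = if L = u then 1 else 0 :=
  (exists_wordCoord b u).choose_spec hu L

theorem sum_wordCoord {n : ℕ} (hn : n < N) {a : HomogeneousAlgebra S} (ha : a ∈ component S n) :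
    ∑ u ∈ words κ n, wordCoord b u a • word S b u = a := by
  classical
  rw [component_eq_span b] at ha
  refine Submodule.span_induction ?_ (by simp) ?_ ?_ ha
  · rintro _ ⟨L, hL, rfl⟩
    rw [Finset.sum_eq_single L]
    · rw [wordCoord_word b (by rw [mem_words.1 hL]; exact hn), if_pos rfl, one_smul]
    · intro u hu hne
      rw [wordCoord_word b (by rw [mem_words.1 hu]; exact hn), if_neg (Ne.symm hne), zero_smul]
    · intro h
      exact absurd hL h
  · intro x y _ _ hx hy
    simp only [map_add, add_smul, Finset.sum_add_distrib, hx, hy]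
  · intro c x _ hx
    simp only [map_smul, smul_assoc, ← Finset.smul_sum, hx]

theorem wordCoord_sum {n : ℕ} (hn : n < N) (c : List κ → k) {u : List κ} (hu : u.length = n) :
    wordCoord b u (∑ L ∈ words κ n, c L • word S b L) = c u := by
  classical
  rw [map_sum, Finset.sum_eq_single u]
  · rw [map_smul, wordCoord_word b (by omega), if_pos rfl, smul_eq_mul, mul_one]
  · intro L _ hne
    rw [map_smul, wordCoord_word b (by omega), if_neg hne, smul_zero]
  · intro h
    exact absurd (mem_words.2 hu) h

end Small

section Augmentation

variable [Fact (2 ≤ N)]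

omit [Fintype κ] in
theorem ε_word (L : List κ) : ε S (word S b L) = if L.length = 0 then 1 else 0 := by
  cases L with
  | nil => simp
  | cons l L => simp [word_cons]

theorem proj_zero (a : HomogeneousAlgebra S) : proj S b 0 a = ε S a • 1 := by
  induction a using word_induction b with
  | word L =>
    rw [proj_word, ε_word]
    split_ifs with h
    · rw [List.length_eq_zero_iff.1 h, one_smul, word_nil]
    · rw [zero_smul]
  | add x y hx hy => rw [map_add, map_add, hx, hy, add_smul]
  | zero => simp
  | smul c x hx => rw [map_smul, map_smul, hx, smul_assoc]

omit [Fintype κ] in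
theorem ε_of_mem {n : ℕ} (hn : n ≠ 0) {a : HomogeneousAlgebra S} (ha : a ∈ component S n) :
    ε S a = 0 := by
  obtain ⟨n, rfl⟩ := Nat.exists_eq_succ_of_ne_zero hn
  rw [component_eq_pow, pow_succ] at ha
  refine Submodule.mul_induction_on ha ?_ ?_
  · rintro x _ _ ⟨v, rfl⟩
    rw [map_mul, ε_ι, mul_zero]
  · intro x y hx hy
    rw [map_add, hx, hy, add_zero]

theorem ε_eq_zero (a : HomogeneousAlgebra S) (ha : ε S a = 0) :
    ∃ c : κ → HomogeneousAlgebra S, a = ∑ l, c l * ι S (b l) := by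
  classical
  have h : ∀ a : HomogeneousAlgebra S, ∃ c : κ → HomogeneousAlgebra S,
      a = ε S a • 1 + ∑ l, c l * ι S (b l) := by
    intro a
    induction a using word_induction b with
    | word L =>
      rcases List.eq_nil_or_concat L with rfl | ⟨L, l, rfl⟩
      · exact ⟨0, by simp⟩
      · refine ⟨Pi.single l (word S b L), ?_⟩
        rw [ε_word, if_neg (by simp), zero_smul, zero_add, Finset.sum_eq_single l]
        · rw [Pi.single_eq_same, List.concat_eq_append, word_append, word_singleton]
        · intro l' _ hne
          rw [Pi.single_eq_of_ne hne, zero_mul]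
        · simp
    | add x y hx hy =>
      obtain ⟨c, hc⟩ := hx
      obtain ⟨c', hc'⟩ := hy
      refine ⟨c + c', ?_⟩
      conv_lhs => rw [hc, hc']
      simp only [map_add, add_smul, Pi.add_apply, add_mul, Finset.sum_add_distrib]
      abel
    | zero => exact ⟨0, by simp⟩
    | smul r x hx =>
      obtain ⟨c, hc⟩ := hx
      refine ⟨r • c, ?_⟩
      conv_lhs => rw [hc]
      simp only [map_smul, smul_add, smul_assoc, Pi.smul_apply, smul_mul_assoc, Finset.smul_sum]
  obtain ⟨c, hc⟩ := h a
  exact ⟨c, by rw [ha, zero_smul, zero_add] at hc; exact hc⟩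

end Augmentation

end Grading

/-! ### Duality between `R` and its orthogonal. -/

section Perp

variable {k : Type u} [Field k] {V : Type v} [AddCommGroup V] [Module k V] {N : ℕ}
  {R : Submodule k (⨂[k]^N V)} {κ : Type w} [Fintype κ] [DecidableEq κ] (b : Module.Basis κ k V)

theorem pairingDual_sum (ρ c : List κ → k) :
    TensorPower.pairingDual k V N
      (∑ z : Fin N → κ, ρ (List.ofFn z) • PiTensorProduct.tprod k (fun i => b.dualBasis (z i)))
      (∑ z : Fin N → κ, c (List.ofFn z) • PiTensorProduct.tprod k (fun i => b (z i))) =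
    ∑ z ∈ words κ N, ρ z * c z := by
  simp only [Module.Basis.coe_dualBasis, map_sum, map_smul, LinearMap.sum_apply,
    LinearMap.smul_apply, pairingDual_coord_tprod, sum_words, smul_eq_mul, mul_ite, mul_one,
    mul_zero, Finset.sum_ite_eq', Finset.mem_univ, if_true]
  exact Finset.sum_congr rfl fun z _ => mul_comm _ _

theorem sum_mul_eq_zero {ρ c : List κ → k} (hρ : IsRel (perp R) b.dualBasis ρ)
    (hc : IsRel R b c) : ∑ z ∈ words κ N, ρ z * c z = 0 := by
  rw [← pairingDual_sum b]
  exact hρ _ hc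

/-- This is `R^⊥⊥ ⊆ R`. A functional that vanishes on `R` but not on the given tensor is the pairing
with the tensor `ρ` whose coordinates are its values on basis tensors, and this `ρ` lies in `R^⊥`.
-/
theorem isRel_of_forall {c : List κ → k}
    (h : ∀ ρ, IsRel (perp R) b.dualBasis ρ → ∑ z ∈ words κ N, ρ z * c z = 0) : IsRel R b c := by
  by_contra hc
  obtain ⟨f, hf, hfR⟩ := Submodule.exists_dual_map_eq_bot_of_notMem hc inferInstance
  have hfR' : ∀ r ∈ R, f r = 0 := fun r hr => by
    have : f r ∈ R.map f := Submodule.mem_map_of_mem hr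
    rwa [hfR, Submodule.mem_bot] at this
  let ρ : List κ → k := fun L => if hL : L.length = N then
    f (PiTensorProduct.tprod k fun i => b (L.get (i.cast hL.symm))) else 0
  have hρz : ∀ z : Fin N → κ, ρ (List.ofFn z) = f (PiTensorProduct.tprod k fun i => b (z i)) := by
    intro z
    simp [ρ]
  have hρf : TensorPower.pairingDual k V N (∑ z : Fin N → κ, ρ (List.ofFn z) •
      PiTensorProduct.tprod k (fun i => b.dualBasis (z i))) = f := by
    apply tensorPower_hom_ext b
    intro z
    simp only [Module.Basis.coe_dualBasis, map_sum, map_smul, LinearMap.sum_apply,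
      LinearMap.smul_apply, pairingDual_coord_tprod, smul_eq_mul, mul_ite, mul_one,
      mul_zero, Finset.sum_ite_eq', Finset.mem_univ, if_true, hρz]
  have hρ : IsRel (perp R) b.dualBasis ρ := by
    intro r hr
    rw [hρf]
    exact hfR' r hr
  have h1 := h ρ hρ
  rw [← pairingDual_sum b, hρf] at h1
  exact hf h1

theorem exists_functional {ρ : List κ → k} (hρ : IsRel (perp R) b.dualBasis ρ) :
    ∃ F : HomogeneousAlgebra R →ₗ[k] k, ∀ L, L.length = N → F (word R b L) = ρ L := by
  obtain ⟨F, hF⟩ := exists_linearMap_of_length R b N ρ (by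
    intro r hr x y hxy
    have hx : x = [] := List.length_eq_zero_iff.1 (by omega)
    have hy : y = [] := List.length_eq_zero_iff.1 (by omega)
    subst hx hy
    rw [← sum_mul_eq_zero b hρ hr]
    refine Finset.sum_congr rfl fun z _ => ?_
    rw [List.nil_append, List.append_nil, smul_eq_mul, mul_comm])
  exact ⟨F, fun L hL => by rw [hF, if_pos hL]⟩

/-- Together with the next lemma: vanishing in `A_N` is tested by pairing with `R^⊥`, that is, with
the relations of `A^!`. This is how conditions pass between the two algebras. -/
theorem sum_smul_word_eq_zero_of_forall {c : List κ → k}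
    (h : ∀ ρ, IsRel (perp R) b.dualBasis ρ → ∑ z ∈ words κ N, ρ z * c z = 0) :
    ∑ z ∈ words κ N, c z • word R b z = 0 :=
  sum_smul_word_eq_zero R b (isRel_of_forall b h)

theorem sum_mul_eq_zero_of_sum_smul_word {c : List κ → k}
    (h : ∑ z ∈ words κ N, c z • word R b z = 0) {ρ : List κ → k}
    (hρ : IsRel (perp R) b.dualBasis ρ) : ∑ z ∈ words κ N, ρ z * c z = 0 := by
  obtain ⟨F, hF⟩ := exists_functional b hρ
  have h1 := congrArg F h
  rw [map_sum, map_zero] at h1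
  rw [← h1]
  refine Finset.sum_congr rfl fun z hz => ?_
  rw [map_smul, hF z (mem_words.1 hz), smul_eq_mul, mul_comm]

end Perp

/-! ### The Koszul `N`-complex as a complex of linear maps from `A^!` to `A`. -/

section Model

variable {k : Type u} [Field k] {V : Type v} [AddCommGroup V] [Module k V]
  [FiniteDimensional k V] {N : ℕ} (R : Submodule k (⨂[k]^N V))

/-- The monomial of `A` given by a word in the chosen basis of `V`. -/
abbrev monom (L : List (Fin (Module.finrank k V))) : HomogeneousAlgebra R :=
  word R (Module.finBasis k V) L

/-- The monomial of `A^!` given by a word in the dual of the chosen basis of `V`. -/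
abbrev dualMonom (L : List (Fin (Module.finrank k V))) : Shriek R :=
  word (perp R) (Module.finBasis k V).dualBasis L

theorem monom_append (L M : List (Fin (Module.finrank k V))) :
    monom R (L ++ M) = monom R L * monom R M := word_append _ _ L M

theorem dualMonom_nil : dualMonom R [] = 1 := rfl

theorem dualMonom_append (L M : List (Fin (Module.finrank k V))) :
    dualMonom R (L ++ M) = dualMonom R L * dualMonom R M := word_append _ _ L M

theorem dualMonom_cons (l : Fin (Module.finrank k V)) (L : List (Fin (Module.finrank k V))) :
    dualMonom R (l :: L) = ι (perp R) ((Module.finBasis k V).dualBasis l) * dualMonom R L :=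
  word_cons _ _ l L

theorem dualMonom_singleton (l : Fin (Module.finrank k V)) :
    dualMonom R [l] = ι (perp R) ((Module.finBasis k V).dualBasis l) :=
  word_singleton _ _ l

/-- The linear maps `A^! → A`; the term `A ⊗ (A^!_m)^*` of the Koszul `N`-complex is identified
with those that vanish on the components of degree different from `m`. -/
abbrev KHom : Type (max u v) := Shriek R →ₗ[k] HomogeneousAlgebra R

/-- The Koszul differential on linear maps `A^! → A`. -/
def kdHom : KHom R →ₗ[HomogeneousAlgebra R] KHom R where
  toFun φ := ∑ l, LinearMap.mulRight k (ι R (Module.finBasis k V l)) ∘ₗ φ ∘ₗ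
    LinearMap.mulLeft k (ι (perp R) ((Module.finBasis k V).dualBasis l))
  map_add' := by
    intro φ ψ
    ext f
    simp [add_mul, Finset.sum_add_distrib]
  map_smul' := by
    intro a φ
    ext f
    simp [Finset.mul_sum, mul_assoc]

variable {R}

theorem kdHom_apply (φ : KHom R) (f : Shriek R) :
    kdHom R φ f = ∑ l, φ (ι (perp R) ((Module.finBasis k V).dualBasis l) * f) *
      ι R (Module.finBasis k V l) := by
  simp [kdHom]

/-- Each further differential inserts its letter directly to the left of `f` and at the right end of
the value, so the same word appears in the same order on both sides. -/
theorem kdHom_pow_apply (p : ℕ) (φ : KHom R) (f : Shriek R) :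
    (kdHom R ^ p) φ f = ∑ L ∈ words _ p, φ (dualMonom R L * f) * monom R L := by
  induction p generalizing φ with
  | zero => simp [sum_words_zero]
  | succ p ih =>
    rw [pow_succ, Module.End.mul_apply, ih, add_comm p 1, sum_words_add, sum_words_one,
      Finset.sum_comm]
    refine Finset.sum_congr rfl fun L _ => ?_
    rw [kdHom_apply, Finset.sum_mul]
    refine Finset.sum_congr rfl fun l _ => ?_
    simp only [List.singleton_append, word_cons, mul_assoc]

variable (R) in
/-- The linear maps `A^! → A` that vanish on the components of degree different from `m`. -/
def KDeg (m : ℕ) : Submodule (HomogeneousAlgebra R) (KHom R) where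
  carrier := {φ | ∀ L, L.length ≠ m → φ (dualMonom R L) = 0}
  add_mem' := by
    intro φ ψ hφ hψ L hL
    rw [LinearMap.add_apply, hφ L hL, hψ L hL, add_zero]
  zero_mem' := fun _ _ => rfl
  smul_mem' := by
    intro a φ hφ L hL
    rw [LinearMap.smul_apply, hφ L hL, smul_zero]

theorem kdHom_mem {m : ℕ} {φ : KHom R} (hφ : φ ∈ KDeg R (m + 1)) : kdHom R φ ∈ KDeg R m := by
  intro L hL
  rw [kdHom_apply]
  refine Finset.sum_eq_zero fun l _ => ?_
  rw [← word_cons, hφ (l :: L) (by simpa using hL), zero_mul]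

theorem kdHom_pow_mem {m p : ℕ} {φ : KHom R} (hφ : φ ∈ KDeg R (m + p)) :
    (kdHom R ^ p) φ ∈ KDeg R m := by
  induction p generalizing φ with
  | zero => exact hφ
  | succ p ih =>
    rw [pow_succ, Module.End.mul_apply]
    exact ih (kdHom_mem hφ)

theorem apply_proj {m : ℕ} {φ : KHom R} (hφ : φ ∈ KDeg R m) (f : Shriek R) :
    φ (proj (perp R) (Module.finBasis k V).dualBasis m f) = φ f := by
  induction f using word_induction (Module.finBasis k V).dualBasis with
  | word L =>
    rw [proj_word]
    split_ifs with h
    · rfl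
    · rw [map_zero, hφ L h]
  | add x y hx hy => rw [map_add, map_add, map_add, hx, hy]
  | zero => simp
  | smul c x hx => rw [map_smul, map_smul, map_smul, hx]

theorem apply_eq_zero_of_mem {m n : ℕ} {φ : KHom R} (hφ : φ ∈ KDeg R m) {f : Shriek R}
    (hf : f ∈ shriekComponent R n) (hn : n ≠ m) : φ f = 0 := by
  rw [← apply_proj hφ, proj_of_mem _ hf, if_neg hn, map_zero]

theorem kHom_ext {m : ℕ} {φ ψ : KHom R} (hφ : φ ∈ KDeg R m) (hψ : ψ ∈ KDeg R m)
    (h : ∀ L : List _, L.length = m → φ (dualMonom R L) = ψ (dualMonom R L)) : φ = ψ := by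
  apply ext_word (Module.finBasis k V).dualBasis
  intro L
  by_cases hL : L.length = m
  · exact h L hL
  · rw [hφ L hL, hψ L hL]

variable (R) in
/-- The projection of `A^!` to its component of degree `m`. -/
def projComponent (m : ℕ) : Shriek R →ₗ[k] shriekComponent R m :=
  (proj (perp R) (Module.finBasis k V).dualBasis m).codRestrict _ (proj_mem _ m)

theorem projComponent_coe {m : ℕ} (f : shriekComponent R m) : projComponent R m f = f := by
  apply Subtype.ext
  change proj (perp R) (Module.finBasis k V).dualBasis m f = f
  rw [proj_of_mem _ f.2, if_pos rfl]

theorem projComponent_ι_mul (m : ℕ) (l : Fin (Module.finrank k V)) (f : Shriek R) :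
    projComponent R (m + 1) (ι (perp R) ((Module.finBasis k V).dualBasis l) * f) =
      mulLeft R ((Module.finBasis k V).coord l) m (projComponent R m f) := by
  apply Subtype.ext
  change proj (perp R) _ (m + 1) _ = ι (perp R) _ * proj (perp R) _ m f
  rw [proj_ι_mul, Module.Basis.coe_dualBasis]

variable (R) in
/-- The embedding of `A ⊗ (A^!_m)^*` into the space of linear maps `A^! → A`. -/
def toHom (m : ℕ) : KTerm R m →ₗ[HomogeneousAlgebra R] KHom R :=
  TensorProduct.AlgebraTensorModule.lift
    (LinearMap.toSpanSingleton (HomogeneousAlgebra R)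
      (Module.Dual k (shriekComponent R m) →ₗ[k] KHom R)
      { toFun := fun α => (α ∘ₗ projComponent R m).smulRight 1
        map_add' := by
          intro α β
          ext f
          simp [add_smul]
        map_smul' := by
          intro c α
          ext f
          simp [mul_smul] })

theorem toHom_tmul (m : ℕ) (a : HomogeneousAlgebra R)
    (α : Module.Dual k (shriekComponent R m)) (f : Shriek R) :
    toHom R m (a ⊗ₜ α) f = α (projComponent R m f) • a := by
  change a * (α (projComponent R m f) • (1 : HomogeneousAlgebra R)) = _
  rw [mul_smul_comm, mul_one]

theorem toHom_mem (m : ℕ) (x : KTerm R m) : toHom R m x ∈ KDeg R m := by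
  induction x using TensorProduct.induction_on with
  | zero =>
    rw [map_zero]
    exact zero_mem _
  | add x y hx hy =>
    rw [map_add]
    exact add_mem hx hy
  | tmul a α =>
    intro L hL
    have h : projComponent R m (dualMonom R L) = 0 := by
      apply Subtype.ext
      change proj (perp R) (Module.finBasis k V).dualBasis m (dualMonom R L) = 0
      rw [proj_word, if_neg hL]
    rw [toHom_tmul, h, map_zero, zero_smul]

theorem toHom_kd (m : ℕ) (x : KTerm R (m + 1)) :
    toHom R m (kd R m x) = kdHom R (toHom R (m + 1) x) := by
  induction x using TensorProduct.induction_on with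
  | zero => simp only [map_zero]
  | add x y hx hy => simp only [map_add, hx, hy]
  | tmul a α =>
    ext f
    rw [kd_tmul, map_sum, kdHom_apply, LinearMap.sum_apply]
    refine Finset.sum_congr rfl fun l _ => ?_
    rw [toHom_tmul, toHom_tmul, projComponent_ι_mul, smul_mul_assoc]
    rfl

theorem toHom_kdIter (m p : ℕ) (x : KTerm R (m + p)) :
    toHom R m (kdIter R m p x) = (kdHom R ^ p) (toHom R (m + p) x) := by
  induction p with
  | zero => rfl
  | succ p ih =>
    rw [kdIter, LinearMap.comp_apply, ih, pow_succ, Module.End.mul_apply, toHom_kd]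
    rfl

instance (n : ℕ) : FiniteDimensional k (shriekComponent R n) := by
  rw [shriekComponent, component_eq_span (Module.finBasis k V).dualBasis]
  exact FiniteDimensional.span_of_finite k (Set.toFinite _)

theorem eq_sum_toHom {m : ℕ} {κ : Type*} [Fintype κ] (β : Module.Basis κ k (shriekComponent R m))
    (x : KTerm R m) : x = ∑ w, toHom R m x (β w) ⊗ₜ[k] β.coord w := by
  induction x using TensorProduct.induction_on with
  | zero => simp
  | add x y hx hy =>
    conv_lhs => rw [hx, hy]
    simp only [map_add, LinearMap.add_apply, TensorProduct.add_tmul, Finset.sum_add_distrib]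
  | tmul a α =>
    simp only [toHom_tmul, projComponent_coe, TensorProduct.smul_tmul, ← TensorProduct.tmul_sum]
    congr 1
    exact (β.sum_dual_apply_smul_coord α).symm

theorem toHom_injective (m : ℕ) : Function.Injective (toHom R m) := by
  intro x y h
  rw [eq_sum_toHom (Module.finBasis k _) x, h, ← eq_sum_toHom]

theorem exists_toHom_eq {m : ℕ} {φ : KHom R} (hφ : φ ∈ KDeg R m) : ∃ x, toHom R m x = φ := by
  let β := Module.finBasis k (shriekComponent R m)
  refine ⟨∑ w, φ (β w) ⊗ₜ[k] β.coord w, ?_⟩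
  ext f
  rw [map_sum, LinearMap.sum_apply]
  simp only [toHom_tmul]
  rw [← apply_proj hφ]
  change _ = φ (projComponent R m f)
  conv_rhs => rw [← β.sum_repr (projComponent R m f)]
  rw [Submodule.coe_sum, map_sum]
  refine Finset.sum_congr rfl fun w _ => ?_
  rw [Submodule.coe_smul, map_smul]
  rfl

/-- A linear endomorphism of the space of maps `A^! → A` restricts to terms of the Koszul
complex. -/
theorem exists_restrict {m n : ℕ} (T : KHom R →ₗ[HomogeneousAlgebra R] KHom R)
    (hT : ∀ φ ∈ KDeg R m, T φ ∈ KDeg R n) :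
    ∃ T' : KTerm R m →ₗ[HomogeneousAlgebra R] KTerm R n,
      ∀ x, toHom R n (T' x) = T (toHom R m x) := by
  choose F hF using fun x => exists_toHom_eq (hT _ (toHom_mem m x))
  refine ⟨{ toFun := F, map_add' := ?_, map_smul' := ?_ }, hF⟩
  · intro x y
    apply toHom_injective
    rw [hF, map_add, map_add, map_add, hF, hF]
  · intro a x
    apply toHom_injective
    rw [hF, map_smul, map_smul, map_smul, hF]
    rfl

theorem kEval_eq [Fact (2 ≤ N)] {m : ℕ} (f : shriekComponent R m) (x : KTerm R m) :
    kEval R m f x = toTrivial R (ε R (toHom R m x f)) := by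
  induction x using TensorProduct.induction_on with
  | zero => simp only [map_zero, LinearMap.zero_apply]
  | add x y hx hy => simp only [map_add, LinearMap.add_apply, hx, hy]
  | tmul a α =>
    rw [kEval_tmul, toHom_tmul, projComponent_coe, map_smul, smul_eq_mul, mul_comm]

end Model

/-! ### Preimages in the critical degrees, and the extra condition. -/

section Kernel

variable {k : Type u} [Field k] {V : Type v} [AddCommGroup V] [Module k V]
  [FiniteDimensional k V] {N : ℕ} {R : Submodule k (⨂[k]^N V)}

theorem sum_smul_mul_mul_eq_zero {ρ : List (Fin (Module.finrank k V)) → k}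
    (hρ : IsRel (perp R) (Module.finBasis k V).dualBasis ρ) {Y : Type*} [AddCommGroup Y]
    [Module k Y] (φ : Shriek R →ₗ[k] Y) (f g : Shriek R) :
    ∑ z ∈ words _ N, ρ z • φ (f * dualMonom R z * g) = 0 := by
  have h : ∑ z ∈ words _ N, ρ z • φ (f * dualMonom R z * g) =
      φ (f * (∑ z ∈ words _ N, ρ z • dualMonom R z) * g) := by
    rw [Finset.mul_sum, Finset.sum_mul, map_sum]
    refine Finset.sum_congr rfl fun z _ => ?_
    rw [mul_smul_comm, smul_mul_assoc, map_smul]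
  rw [h, sum_smul_word_eq_zero _ _ hρ, mul_zero, zero_mul, map_zero]

/-- Since `s < N`, values in `A_s` are tensors. The equation `(d^t φ)(f) = 0` takes place in `A_N`,
so it says that the tensor with coordinate at `uw` the coordinate of `φ(wf)` at `u` is annihilated
by `R^⊥`. -/
theorem sum_mul_wordCoord_eq_zero {s t : ℕ} (hst : s + t = N) (ht : t ≠ 0) {φ : KHom R}
    (hs : ∀ f, φ f ∈ component R s) (hφ : (kdHom R ^ t) φ = 0)
    {ρ : List (Fin (Module.finrank k V)) → k}
    (hρ : IsRel (perp R) (Module.finBasis k V).dualBasis ρ) (f : Shriek R) :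
    ∑ z ∈ words _ N, ρ z * wordCoord (Module.finBasis k V) (z.take s)
      (φ (dualMonom R (z.drop s) * f)) = 0 := by
  refine sum_mul_eq_zero_of_sum_smul_word (Module.finBasis k V)
    (c := fun z => wordCoord (Module.finBasis k V) (z.take s) (φ (dualMonom R (z.drop s) * f)))
    ?_ hρ
  have h := LinearMap.congr_fun hφ f
  rw [kdHom_pow_apply] at h
  subst hst
  rw [sum_words_add, Finset.sum_comm]
  refine Eq.trans (Finset.sum_congr rfl fun w _ => ?_) h
  rw [← sum_wordCoord (Module.finBasis k V) (by omega) (hs (dualMonom R w * f)), Finset.sum_mul]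
  refine Finset.sum_congr rfl fun u hu => ?_
  rw [mem_words] at hu
  rw [word_append, smul_mul_assoc, List.take_left' hu, List.drop_left' hu]

/-- The preimage has scalar values: on `uv`, with `u` of length `s`, it is the coordinate of `φ(v)`
at `u`, and the formula for `d^s` then reassembles `φ(v)`. The hypothesis `H` expresses that
relations starting among the first `s` letters are respected. -/
theorem exists_kdHom_pow_eq {m s : ℕ} (hsN : s < N) {φ : KHom R} (hm : φ ∈ KDeg R m)
    (hs : ∀ f, φ f ∈ component R s)
    (H : ∀ ρ, IsRel (perp R) (Module.finBasis k V).dualBasis ρ → ∀ x y : List _,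
      x.length + N + y.length = m + s → x.length < s →
      ∑ z ∈ words _ N, ρ z * wordCoord (Module.finBasis k V) ((x ++ z ++ y).take s)
        (φ (dualMonom R ((x ++ z ++ y).drop s))) = 0) :
    ∃ ψ ∈ KDeg R (m + s), (kdHom R ^ s) ψ = φ := by
  obtain ⟨ψ, hψ⟩ := exists_linearMap_of_length (perp R) (Module.finBasis k V).dualBasis (m + s)
    (fun L => wordCoord (Module.finBasis k V) (L.take s) (φ (dualMonom R (L.drop s))) •
      (1 : HomogeneousAlgebra R)) (by
    intro ρ hρ x y hxy
    simp only [← smul_assoc, smul_eq_mul, ← Finset.sum_smul]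
    by_cases hx : x.length < s
    · rw [H ρ hρ x y hxy hx, zero_smul]
    -- The relation starts after the first `s` letters, hence lies in the argument of `φ`, where it
    -- is zero in `A^!`.
    · have h := sum_smul_mul_mul_eq_zero hρ
        (wordCoord (Module.finBasis k V) (x.take s) ∘ₗ φ) (dualMonom R (x.drop s)) (dualMonom R y)
      convert zero_smul k (1 : HomogeneousAlgebra R) using 2
      rw [← h]
      refine Finset.sum_congr rfl fun z _ => ?_
      rw [LinearMap.comp_apply, List.append_assoc, List.take_append_of_le_length (by omega),
        List.drop_append_of_le_length (by omega), dualMonom_append, dualMonom_append, ← mul_assoc,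
        smul_eq_mul])
  have hψm : ψ ∈ KDeg R (m + s) := fun L hL => by rw [hψ, if_neg hL]
  refine ⟨ψ, hψm, ?_⟩
  refine kHom_ext (kdHom_pow_mem hψm) hm fun M hM => ?_
  rw [kdHom_pow_apply, ← sum_wordCoord (Module.finBasis k V) hsN (hs (dualMonom R M))]
  refine Finset.sum_congr rfl fun u hu => ?_
  rw [mem_words] at hu
  rw [← word_append, hψ, if_pos (by simp; omega), List.take_left' hu, List.drop_left' hu,
    smul_mul_assoc, one_mul]

/-- With `s = 1`, a relation starting before position `s` starts at the very beginning, where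
`d^{N-1} φ = 0` applies. No extra condition is needed. -/
theorem exists_kdHom_eq {m t : ℕ} (ht : 1 + t = N) (ht0 : t ≠ 0) {φ : KHom R}
    (hm : φ ∈ KDeg R m) (hs : ∀ f, φ f ∈ component R 1) (hφ : (kdHom R ^ t) φ = 0) :
    ∃ ψ ∈ KDeg R (m + 1), kdHom R ψ = φ := by
  have h := exists_kdHom_pow_eq (by omega) hm hs (fun ρ hρ x y _ hx => by
    obtain rfl : x = [] := List.length_eq_zero_iff.1 (by omega)
    rw [← sum_mul_wordCoord_eq_zero ht ht0 hs hφ hρ (dualMonom R y)]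
    refine Finset.sum_congr rfl fun z hz => ?_
    rw [mem_words] at hz
    rw [List.nil_append, List.take_append_of_le_length (by omega),
        List.drop_append_of_le_length (by omega), dualMonom_append])
  rwa [pow_one] at h

variable (R) in
/-- The extra condition of Berger, in terms of functions on words (tensors): a tensor lying in
`V^{⊗p} ⊗ R` and in `R ⊗ V^{⊗p}`, with `p < N`, lies in all `V^{⊗a} ⊗ R ⊗ V^{⊗(p-a)}`. -/
def ExtraCondition : Prop :=
  ∀ p < N, ∀ X : List (Fin (Module.finrank k V)) → k,
    (∀ ρ, IsRel (perp R) (Module.finBasis k V).dualBasis ρ → ∀ u, u.length = p →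
      ∑ z ∈ words _ N, ρ z * X (u ++ z) = 0) →
    (∀ ρ, IsRel (perp R) (Module.finBasis k V).dualBasis ρ → ∀ w, w.length = p →
      ∑ z ∈ words _ N, ρ z * X (z ++ w) = 0) →
    ∀ ρ, IsRel (perp R) (Module.finBasis k V).dualBasis ρ → ∀ x y, x.length + y.length = p →
      ∑ z ∈ words _ N, ρ z * X (x ++ z ++ y) = 0

/-- Now `s = N - 1`, and a relation may straddle the cut after `s` letters. In a window of `2N - 1`
letters, the relations at the right end vanish because `φ` is defined on `A^!`, those at the left
end because `dφ = 0`; the extra condition supplies all positions in between. -/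
theorem ExtraCondition.exists_kdHom_pow_eq (hR : ExtraCondition R) {m s : ℕ} (hs1 : s + 1 = N)
    (hNm : N ≤ m) {φ : KHom R} (hm : φ ∈ KDeg R m) (hs : ∀ f, φ f ∈ component R s)
    (hφ : kdHom R φ = 0) : ∃ ψ ∈ KDeg R (m + s), (kdHom R ^ s) ψ = φ := by
  refine HomogeneousAlgebra.exists_kdHom_pow_eq (by omega) hm hs fun ρ hρ x y hxy hx => ?_
  let X : List (Fin (Module.finrank k V)) → k := fun L =>
    wordCoord (Module.finBasis k V) (L.take s) (φ (dualMonom R (L.drop s)))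
  -- The window is `x ++ z ++ y₁`, of length `N + s`. The bound `N ≤ m` makes `y` long enough to
  -- provide `y₁`.
  set y₁ := y.take (s - x.length) with hy₁
  set y₂ := y.drop (s - x.length) with hy₂
  have hy : y = y₁ ++ y₂ := (List.take_append_drop _ _).symm
  have hl : x.length + y₁.length = s := by
    rw [hy₁, List.length_take]
    omega
  have h := hR s (by omega) (fun L => X (L ++ y₂)) ?_ ?_ ρ hρ x y₁ hl
  · rw [← h]
    refine Finset.sum_congr rfl fun z _ => ?_
    simp only [X]
    rw [hy, List.append_assoc, List.append_assoc, List.append_assoc]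
  · intro ρ hρ u hu
    have h := sum_smul_mul_mul_eq_zero hρ
        (wordCoord (Module.finBasis k V) u ∘ₗ φ) 1 (dualMonom R y₂)
    rw [← h]
    refine Finset.sum_congr rfl fun z _ => ?_
    simp only [X]
    rw [LinearMap.comp_apply, List.append_assoc, List.take_left' hu, List.drop_left' hu,
      dualMonom_append, one_mul, smul_eq_mul]
  · intro ρ hρ w hw
    rw [← sum_mul_wordCoord_eq_zero hs1 one_ne_zero hs (by rw [pow_one]; exact hφ) hρ
      (dualMonom R (w ++ y₂))]
    refine Finset.sum_congr rfl fun z hz => ?_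
    rw [mem_words] at hz
    simp only [X]
    rw [List.append_assoc, List.take_append_of_le_length (by omega),
        List.drop_append_of_le_length (by omega), dualMonom_append]

theorem wordCoord_mul_ι {p : ℕ} (hp : p + 1 < N) {x : List (Fin (Module.finrank k V))}
    (hx : x.length = p) (l l' : Fin (Module.finrank k V)) (a : HomogeneousAlgebra R) :
    wordCoord (Module.finBasis k V) (x ++ [l]) (a * ι R (Module.finBasis k V l')) =
      if l' = l then wordCoord (Module.finBasis k V) x a else 0 := by
  induction a using word_induction (Module.finBasis k V) with
  | word L =>
    rw [← word_singleton R (Module.finBasis k V), ← word_append,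
      wordCoord_word _ (by simp; omega), wordCoord_word _ (by omega)]
    have h : L ++ [l'] = x ++ [l] ↔ l' = l ∧ L = x := by
      constructor
      · intro h
        obtain ⟨h1, h2⟩ := List.append_inj' h rfl
        exact ⟨by simpa using h2, h1⟩
      · rintro ⟨rfl, rfl⟩
        rfl
    simp only [h, ite_and]
    split_ifs <;> rfl
  | add a a' ha ha' =>
    rw [add_mul, map_add, ha, ha', map_add]
    split_ifs <;> simp
  | zero => simp
  | smul c a ha =>
    rw [smul_mul_assoc, map_smul, ha, map_smul]
    split_ifs <;> simp

/-- Cutting `X` after `p + 1` letters yields a map `φ` on `A^!_N` with values in `A_{p+1}`: well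
defined by the condition on the right, and with `d^{N-1} φ = 0` by the condition on the left. A
preimage `ψ` under `d` is defined on `A^!_{N+1}`, so the cut can be moved one letter to the left;
relations of `A^!` in the argument of `ψ` give the new condition. -/
theorem extraCondition_step (hN : N ≠ 0)
    (H : ∀ φ ∈ KDeg R N, (kdHom R ^ (N - 1)) φ = 0 → ∃ ψ ∈ KDeg R (N + 1), kdHom R ψ = φ)
    {p : ℕ} (hp : p + 1 < N) (X : List (Fin (Module.finrank k V)) → k)
    (hl : ∀ ρ, IsRel (perp R) (Module.finBasis k V).dualBasis ρ → ∀ u, u.length = p + 1 →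
      ∑ z ∈ words _ N, ρ z * X (u ++ z) = 0)
    (hr : ∀ ρ, IsRel (perp R) (Module.finBasis k V).dualBasis ρ → ∀ w, w.length = p + 1 →
      ∑ z ∈ words _ N, ρ z * X (z ++ w) = 0)
    (ρ : List (Fin (Module.finrank k V)) → k)
    (hρ : IsRel (perp R) (Module.finBasis k V).dualBasis ρ)
    (x : List (Fin (Module.finrank k V))) (hx : x.length = p) (l : Fin (Module.finrank k V)) :
    ∑ z ∈ words _ N, ρ z * X (x ++ z ++ [l]) = 0 := by
  obtain ⟨φ, hφ⟩ := exists_linearMap_of_length (perp R) (Module.finBasis k V).dualBasis N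
    (fun z => ∑ u ∈ words _ (p + 1), X (u ++ z) • monom R u) (by
      intro ρ hρ x y hxy
      obtain rfl : x = [] := List.length_eq_zero_iff.1 (by omega)
      obtain rfl : y = [] := List.length_eq_zero_iff.1 (by omega)
      simp only [List.nil_append, List.append_nil, Finset.smul_sum]
      rw [Finset.sum_comm]
      refine Finset.sum_eq_zero fun u hu => ?_
      simp only [← smul_assoc, smul_eq_mul, ← Finset.sum_smul]
      rw [hl ρ hρ u (mem_words.1 hu), zero_smul])
  have hφm : φ ∈ KDeg R N := fun L hL => by rw [hφ, if_neg hL]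
  have hφ0 : (kdHom R ^ (N - 1)) φ = 0 := by
    refine kHom_ext (m := 1) (kdHom_pow_mem (by rwa [Nat.add_sub_cancel' (by omega)]))
      (zero_mem _) fun M hM => ?_
    obtain ⟨l', rfl⟩ := List.length_eq_one_iff.1 hM
    rw [kdHom_pow_apply]
    have h1 : ∑ w ∈ words _ (N - 1), φ (dualMonom R w * dualMonom R [l']) * monom R w =
        ∑ L ∈ words _ (p + 1 + (N - 1)), X (L ++ [l']) • monom R L := by
      rw [sum_words_add, Finset.sum_comm]
      refine Finset.sum_congr rfl fun w hw => ?_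
      rw [mem_words] at hw
      rw [← word_append, hφ, if_pos (by simp; omega), Finset.sum_mul]
      refine Finset.sum_congr rfl fun u _ => ?_
      rw [smul_mul_assoc, ← word_append, List.append_assoc]
    -- Regrouping the letters as `N + p` exposes the first `N` of them, on which the condition on
    -- the left says that the sum is already zero in `A_N`.
    rw [h1, show p + 1 + (N - 1) = N + p by omega, sum_words_add, Finset.sum_comm]
    refine Finset.sum_eq_zero fun w hw => ?_
    rw [mem_words] at hw
    have h2 : ∑ z ∈ words _ N, X (z ++ (w ++ [l'])) • monom R z = 0 :=
      sum_smul_word_eq_zero_of_forall (Module.finBasis k V) (fun ρ hρ => hr ρ hρ _ (by simp [hw]))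
    have h3 := congrArg (· * monom R w) h2
    simp only [Finset.sum_mul, zero_mul] at h3
    refine Eq.trans (Finset.sum_congr rfl fun z _ => ?_) h3
    rw [monom_append, smul_mul_assoc, List.append_assoc]
  obtain ⟨ψ, -, hψ⟩ := H φ hφm hφ0
  -- Comparing the coordinates of `φ = dψ` at `x ++ [l]`; words of length `p + 1` are independent
  -- because `p + 1 < N`.
  have key : ∀ (l : Fin (Module.finrank k V)) (z : List (Fin (Module.finrank k V))),
      z.length = N → X (x ++ l :: z) =
        wordCoord (Module.finBasis k V) x (ψ (dualMonom R (l :: z))) := by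
    intro l z hz
    have h1 : wordCoord (Module.finBasis k V) (x ++ [l]) (φ (dualMonom R z)) =
        X (x ++ l :: z) := by
      rw [hφ, if_pos hz, wordCoord_sum _ hp (fun u => X (u ++ z)) (by simp [hx])]
      simp
    rw [← h1, ← hψ, kdHom_apply, map_sum]
    simp only [wordCoord_mul_ι hp hx]
    rw [Finset.sum_ite_eq' Finset.univ l, if_pos (Finset.mem_univ _), dualMonom_cons]
  have h := sum_smul_mul_mul_eq_zero hρ
        (wordCoord (Module.finBasis k V) x ∘ₗ ψ) 1 (dualMonom R [l])
  rw [← h]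
  refine Finset.sum_congr rfl fun z hz => ?_
  rw [mem_words] at hz
  rw [one_mul, smul_eq_mul, LinearMap.comp_apply, ← word_append]
  cases z with
  | nil => exact absurd hz.symm hN
  | cons l' z =>
    rw [List.append_assoc, List.cons_append, key]
    simpa using hz

/-- Induction on the excess length `p`. By `extraCondition_step`, the condition at the right end
also holds one position earlier; fixing the last letter then leaves a tensor of excess `p`
satisfying both end conditions. -/
theorem extraCondition_of_exact (hN : N ≠ 0)
    (H : ∀ φ ∈ KDeg R N, (kdHom R ^ (N - 1)) φ = 0 → ∃ ψ ∈ KDeg R (N + 1), kdHom R ψ = φ) :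
    ExtraCondition R := by
  intro p
  induction p with
  | zero =>
    intro _ X hl _ ρ hρ x y hxy
    obtain rfl : y = [] := List.length_eq_zero_iff.1 (by omega)
    simpa using hl ρ hρ x (by simpa using hxy)
  | succ p ih =>
    intro hp X hl hr ρ hρ x y hxy
    rcases List.eq_nil_or_concat y with rfl | ⟨y, l, rfl⟩
    · simpa using hl ρ hρ x (by simpa using hxy)
    · simp only [List.concat_eq_append, List.length_append, List.length_singleton] at hxy ⊢
      have h := ih (by omega) (fun L => X (L ++ [l]))
        (fun ρ hρ u hu => extraCondition_step hN H hp X hl hr ρ hρ u hu l)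
        (fun ρ hρ w hw => by
          simpa [List.append_assoc] using hr ρ hρ (w ++ [l]) (by simp [hw]))
        ρ hρ x y (by omega)
      simpa [List.append_assoc] using h

end Kernel

/-! ### Exactness at the first two terms, from generators and relations. -/

section LowDegree

variable {k : Type u} [Field k] {V : Type v} [AddCommGroup V] [Module k V]
  [FiniteDimensional k V] {N : ℕ} {R : Submodule k (⨂[k]^N V)}

theorem exists_kdHom_eq_zero [Fact (2 ≤ N)] {φ : KHom R} (hφ : φ ∈ KDeg R 0)
    (h : ε R (φ 1) = 0) : ∃ ψ ∈ KDeg R 1, kdHom R ψ = φ := by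
  obtain ⟨c, hc⟩ := ε_eq_zero (Module.finBasis k V) _ h
  obtain ⟨ψ, hψ⟩ := exists_linearMap_of_length (perp R) (Module.finBasis k V).dualBasis 1
    (fun L => L.head?.elim 0 c) (fun _ _ x y hxy => by
      have := (inferInstance : Fact (2 ≤ N)).out
      omega)
  have hψm : ψ ∈ KDeg R 1 := fun L hL => by rw [hψ, if_neg hL]
  refine ⟨ψ, hψm, ?_⟩
  refine kHom_ext (m := 0) (kdHom_mem hψm) hφ fun L hL => ?_
  obtain rfl := List.length_eq_zero_iff.1 hL
  rw [dualMonom_nil, hc, kdHom_apply]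
  refine Finset.sum_congr rfl fun l _ => ?_
  rw [mul_one, ← word_singleton (perp R) (Module.finBasis k V).dualBasis, hψ]
  rfl

variable (R) in
/-- The evaluation of a map `A^! → A` at the generators of `A^!`. -/
def evalGenerators : KHom R →ₗ[HomogeneousAlgebra R]
    (Fin (Module.finrank k V) → HomogeneousAlgebra R) where
  toFun φ l := φ (dualMonom R [l])
  map_add' _ _ := rfl
  map_smul' _ _ := rfl

variable (R) in
/-- The submodule of relations of the left module `A₊`, generated by `R`. -/
def relationSubmodule : Submodule (HomogeneousAlgebra R)
    (Fin (Module.finrank k V) → HomogeneousAlgebra R) :=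
  (KDeg R N).map (evalGenerators R ∘ₗ kdHom R ^ (N - 1))

theorem sum_smul_single_mem (hN : N ≠ 0) {r : List (Fin (Module.finrank k V)) → k}
    (hr : IsRel R (Module.finBasis k V) r) (x : List (Fin (Module.finrank k V))) :
    ∑ w ∈ words _ (N - 1), ∑ l, r (w ++ [l]) • Pi.single l (monom R (x ++ w)) ∈
      relationSubmodule R := by
  obtain ⟨ψ, hψ⟩ := exists_linearMap_of_length (perp R) (Module.finBasis k V).dualBasis N
    (fun z => r z • monom R x) (by
      intro ρ hρ x y hxy
      obtain rfl : x = [] := List.length_eq_zero_iff.1 (by omega)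
      obtain rfl : y = [] := List.length_eq_zero_iff.1 (by omega)
      simp only [List.nil_append, List.append_nil, ← smul_assoc, smul_eq_mul, ← Finset.sum_smul]
      rw [sum_mul_eq_zero _ hρ hr, zero_smul])
  refine ⟨ψ, fun L hL => by rw [hψ, if_neg hL], ?_⟩
  ext l
  rw [LinearMap.comp_apply]
  change (kdHom R ^ (N - 1)) ψ (dualMonom R [l]) = _
  rw [kdHom_pow_apply, Finset.sum_apply]
  refine Finset.sum_congr rfl fun w hw => ?_
  rw [mem_words] at hw
  rw [Finset.sum_apply, Finset.sum_eq_single l]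
  · rw [Pi.smul_apply, Pi.single_eq_same, ← word_append, hψ, if_pos (by simp; omega), monom_append,
      smul_mul_assoc]
  · intro l' _ hne
    rw [Pi.smul_apply, Pi.single_eq_of_ne (Ne.symm hne), smul_zero]
  · simp

/-- Removing the last letter of a word sends `A₊ = AV` back to the free module on the generators,
modulo the relations. It is well defined: a relation that includes the last letter goes into
`relationSubmodule`, any other is already zero in `A` once that letter is removed. -/
theorem exists_toQuotient (hN : N ≠ 0) : ∃ F : HomogeneousAlgebra R →ₗ[k]
    ((Fin (Module.finrank k V) → HomogeneousAlgebra R) ⧸ relationSubmodule R),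
    ∀ (a : HomogeneousAlgebra R) (l : Fin (Module.finrank k V)),
      F (a * ι R (Module.finBasis k V l)) = (relationSubmodule R).mkQ (Pi.single l a) := by
  let q := (relationSubmodule R).mkQ.restrictScalars k
  -- The value `0` on the empty word is arbitrary: the map is used on `AV` only.
  let c : List (Fin (Module.finrank k V)) →
      ((Fin (Module.finrank k V) → HomogeneousAlgebra R) ⧸ relationSubmodule R) :=
    fun L => L.getLast?.elim 0 fun l => q (Pi.single l (monom R L.dropLast))
  have hc : ∀ L l, c (L ++ [l]) = q (Pi.single l (monom R L)) := by
    intro L l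
    simp [c]
  obtain ⟨F, hF⟩ := exists_linearMap R (Module.finBasis k V) c (by
    intro r hr x y
    rcases List.eq_nil_or_concat y with rfl | ⟨y, l, rfl⟩
    · have h := sum_smul_single_mem hN hr x
      rw [← Submodule.Quotient.mk_eq_zero] at h
      change q _ = 0 at h
      rw [map_sum] at h
      rw [show words (Fin (Module.finrank k V)) N = words _ (N - 1 + 1) by
        rw [Nat.sub_add_cancel (by omega)], sum_words_add]
      refine Eq.trans (Finset.sum_congr rfl fun w _ => ?_) h
      rw [sum_words_one, map_sum]
      refine Finset.sum_congr rfl fun l _ => ?_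
      rw [List.append_nil, ← List.append_assoc, hc, map_smul]
    · have h : ∑ z ∈ words _ N, r z • monom R (x ++ z ++ y) =
          monom R x * (∑ z ∈ words _ N, r z • monom R z) * monom R y := by
        rw [Finset.mul_sum, Finset.sum_mul]
        refine Finset.sum_congr rfl fun z _ => ?_
        rw [monom_append, monom_append, mul_smul_comm, smul_mul_assoc]
      rw [sum_smul_word_eq_zero R _ hr, mul_zero, zero_mul] at h
      have h2 := congrArg (fun a => q (LinearMap.single k
        (fun _ : Fin (Module.finrank k V) => HomogeneousAlgebra R) l a)) h
      simp only [map_sum, map_smul, map_zero] at h2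
      refine Eq.trans (Finset.sum_congr rfl fun z _ => ?_) h2
      rw [List.concat_eq_append, ← List.append_assoc, hc]
      rfl)
  refine ⟨F, fun a l => ?_⟩
  have h : F ∘ₗ LinearMap.mulRight k (ι R (Module.finBasis k V l)) =
      q ∘ₗ LinearMap.single k (fun _ : Fin (Module.finrank k V) => HomogeneousAlgebra R) l := by
    apply ext_word (Module.finBasis k V)
    intro L
    rw [LinearMap.comp_apply, LinearMap.mulRight_apply,
      ← word_singleton R (Module.finBasis k V), ← word_append, hF, hc]
    rfl
  exact LinearMap.congr_fun h a

/-- Evaluating `dφ = 0` at `1` gives `∑ φ(e_l^*) e_l = 0`. The map of `exists_toQuotient` turns this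
into the statement that the family of the `φ(e_l^*)` lies in `relationSubmodule`, which is the image
of `d^{N-1}`. -/
theorem exists_kdHom_pow_eq_one (hN : N ≠ 0) {φ : KHom R} (hφ : φ ∈ KDeg R 1)
    (h : kdHom R φ = 0) : ∃ ψ ∈ KDeg R N, (kdHom R ^ (N - 1)) ψ = φ := by
  obtain ⟨F, hF⟩ := exists_toQuotient (R := R) hN
  have h1 := congrArg F (LinearMap.congr_fun h 1)
  rw [kdHom_apply, LinearMap.zero_apply, map_zero, map_sum] at h1
  simp only [hF, mul_one] at h1
  rw [← map_sum, Finset.univ_sum_single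
    (fun l => φ (ι (perp R) ((Module.finBasis k V).dualBasis l))), Submodule.mkQ_apply,
    Submodule.Quotient.mk_eq_zero] at h1
  obtain ⟨ψ, hψm, hψ⟩ := h1
  refine ⟨ψ, hψm, kHom_ext (m := 1)
    (kdHom_pow_mem (by rwa [Nat.add_sub_cancel' (by omega)])) hφ fun L hL => ?_⟩
  obtain ⟨l, rfl⟩ := List.length_eq_one_iff.1 hL
  refine (congrFun hψ l).trans ?_
  rw [dualMonom_singleton]

end LowDegree

/-! ### Homogeneous parts in a graded resolution. -/

namespace GradedResolution

variable {k : Type u} [Field k] {V : Type v} [AddCommGroup V] [Module k V] {N : ℕ}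
  {R : Submodule k (⨂[k]^N V)} [Fact (2 ≤ N)] (Q : GradedResolution R)

/-- The homogeneous part of degree `m` of an element of `Q_i`. -/
def part (i : ℕ) (m : ℤ) : Q.X i →+ Q.X i :=
  letI := (Q.isInternal i).chooseDecomposition
  AddMonoidHom.mk' (fun y => (DirectSum.decompose (Q.deg i) y m : Q.X i)) fun x y => by
    rw [DirectSum.decompose_add]
    rfl

theorem part_mem (i : ℕ) (m : ℤ) (x : Q.X i) : Q.part i m x ∈ Q.deg i m := by
  let := (Q.isInternal i).chooseDecomposition
  exact (DirectSum.decompose (Q.deg i) x m).2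

theorem part_of_mem {i : ℕ} {n : ℤ} {x : Q.X i} (hx : x ∈ Q.deg i n) (m : ℤ) :
    Q.part i m x = if n = m then x else 0 := by
  let := (Q.isInternal i).chooseDecomposition
  change (DirectSum.decompose (Q.deg i) x m : Q.X i) = _
  split_ifs with h
  · subst h
    exact DirectSum.decompose_of_mem_same (Q.deg i) hx
  · exact DirectSum.decompose_of_mem_ne (Q.deg i) hx h

theorem hom_ext {i : ℕ} {Y : Type*} [AddCommGroup Y] {f g : Q.X i →+ Y}
    (h : ∀ (m : ℤ) (x : Q.X i), x ∈ Q.deg i m → f x = g x) : f = g := by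
  let := (Q.isInternal i).chooseDecomposition
  ext x
  induction x using DirectSum.Decomposition.inductionOn (Q.deg i) with
  | zero => rw [map_zero, map_zero]
  | homogeneous x => exact h _ _ x.2
  | add x y hx hy => rw [map_add, map_add, hx, hy]

theorem d_part (i : ℕ) (m : ℤ) (y : Q.X (i + 1)) :
    Q.d i (Q.part (i + 1) m y) = Q.part i m (Q.d i y) := by
  have h : (Q.d i).toAddMonoidHom.comp (Q.part (i + 1) m) =
      (Q.part i m).comp (Q.d i).toAddMonoidHom := by
    apply Q.hom_ext
    intro n x hx
    change Q.d i (Q.part (i + 1) m x) = Q.part i m (Q.d i x)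
    rw [Q.part_of_mem hx, Q.part_of_mem (Q.d_mem i n x hx)]
    split_ifs
    · rfl
    · rw [map_zero]
  exact DFunLike.congr_fun h y

theorem aug_part (y : Q.X 0) : Q.aug (Q.part 0 0 y) = Q.aug y := by
  have h : Q.aug.toAddMonoidHom.comp (Q.part 0 0) = Q.aug.toAddMonoidHom := by
    apply Q.hom_ext
    intro n x hx
    change Q.aug (Q.part 0 0 x) = Q.aug x
    rw [Q.part_of_mem hx]
    split_ifs with hn
    · rfl
    · rw [map_zero, Q.aug_eq_zero n x hx hn]
  exact DFunLike.congr_fun h y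

theorem exists_homogeneous_preimage {i : ℕ} {m : ℤ} {x : Q.X i} (hx : x ∈ Q.deg i m)
    (h : x ∈ LinearMap.range (Q.d i)) : ∃ y ∈ Q.deg (i + 1) m, Q.d i y = x := by
  obtain ⟨y, rfl⟩ := h
  exact ⟨_, Q.part_mem (i + 1) m y, by rw [d_part, Q.part_of_mem hx, if_pos rfl]⟩

theorem exists_homogeneous_preimage_aug (c : Trivial R) : ∃ y ∈ Q.deg 0 0, Q.aug y = c := by
  obtain ⟨y, rfl⟩ := Q.isProjectiveResolution.aug_surjective c
  exact ⟨_, Q.part_mem 0 0 y, Q.aug_part y⟩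

end GradedResolution

/-! ### Comparison of the Koszul complex with a graded resolution. -/

section Complex

variable {k : Type u} [Field k] {V : Type v} [AddCommGroup V] [Module k V]
  [FiniteDimensional k V] {N : ℕ} (R : Submodule k (⨂[k]^N V))

/-- The exponent in the differential `P_{i+1} → P_i` of the Koszul complex. -/
def gap (N i : ℕ) : ℕ := if Even i then 1 else N - 1

theorem jump_succ (N i : ℕ) : jump N (i + 1) = jump N i + gap N i := rfl

theorem gap_add_gap {N : ℕ} (hN : 2 ≤ N) (i : ℕ) : gap N i + gap N (i + 1) = N := by
  unfold gap
  by_cases h : Even i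
  · rw [if_pos h, if_neg (by simpa [Nat.even_add_one] using h)]
    omega
  · rw [if_neg h, if_pos (by simpa [Nat.even_add_one] using h)]
    omega

theorem gap_pos {N : ℕ} (hN : 2 ≤ N) (i : ℕ) : 0 < gap N i := by
  unfold gap
  split_ifs <;> omega

variable {R}

/-- Expanding the words of `A^!_N` in a basis, the coefficients along each basis vector form a
linear functional on `A^!_N`. They annihilate `R^⊥`, so they are the coordinates of an element of
`R`, which is zero in `A`. -/
theorem kdHom_pow_N (φ : KHom R) : (kdHom R ^ N) φ = 0 := by
  ext f
  rw [kdHom_pow_apply, LinearMap.zero_apply]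
  let β := Module.finBasis k (shriekComponent R N)
  have h : ∀ z ∈ words _ N, φ (dualMonom R z * f) * monom R z =
      ∑ w, φ (β w * f) * (β.coord w (projComponent R N (dualMonom R z)) • monom R z) := by
    intro z hz
    rw [mem_words] at hz
    have h1 : dualMonom R z = (projComponent R N (dualMonom R z) : Shriek R) := by
      change _ = proj (perp R) _ N _
      rw [proj_word, if_pos hz]
    conv_lhs => rw [h1, ← β.sum_repr (projComponent R N (dualMonom R z)), Submodule.coe_sum,
      Finset.sum_mul, map_sum, Finset.sum_mul]
    refine Finset.sum_congr rfl fun w _ => ?_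
    rw [Submodule.coe_smul, smul_mul_assoc, map_smul, smul_mul_assoc, mul_smul_comm]
    rfl
  rw [Finset.sum_congr rfl h, Finset.sum_comm]
  refine Finset.sum_eq_zero fun w _ => ?_
  rw [← Finset.mul_sum]
  have h2 : ∑ z ∈ words _ N, β.coord w (projComponent R N (dualMonom R z)) • monom R z = 0 := by
    refine sum_smul_word_eq_zero_of_forall (Module.finBasis k V)
      (c := fun z => β.coord w (projComponent R N (dualMonom R z))) fun ρ hρ => ?_
    have h3 := sum_smul_mul_mul_eq_zero hρ (β.coord w ∘ₗ projComponent R N) 1 1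
    simpa only [one_mul, mul_one, LinearMap.comp_apply, smul_eq_mul] using h3
  rw [h2, mul_zero]

theorem kdHom_pow_mem_component {s p : ℕ} {φ : KHom R} (hφ : ∀ f, φ f ∈ component R s)
    (f : Shriek R) : (kdHom R ^ p) φ f ∈ component R (s + p) := by
  rw [kdHom_pow_apply]
  refine Submodule.sum_mem _ fun L hL => ?_
  rw [mem_words] at hL
  rw [← hL]
  exact mul_mem_component (hφ _) (word_mem_component _ L)

variable [Fact (2 ≤ N)]

variable (R) in
/-- The terms of the Koszul complex, as spaces of linear maps `A^! → A`. -/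
def toHomX (i : ℕ) : (koszulComplex R).X i →ₗ[HomogeneousAlgebra R] KHom R := toHom R (jump N i)

theorem toHomX_injective (i : ℕ) : Function.Injective (toHomX R i) := toHom_injective _

theorem toHomX_mem (i : ℕ) (x : (koszulComplex R).X i) : toHomX R i x ∈ KDeg R (jump N i) :=
  toHom_mem _ x

theorem exists_toHomX_eq {i : ℕ} {φ : KHom R} (hφ : φ ∈ KDeg R (jump N i)) :
    ∃ x, toHomX R i x = φ := exists_toHom_eq hφ

theorem toHomX_d (i : ℕ) (x : (koszulComplex R).X (i + 1)) :
    toHomX R i ((koszulComplex R).d i x) = (kdHom R ^ gap N i) (toHomX R (i + 1) x) :=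
  toHom_kdIter _ _ x

theorem aug_apply (x : (koszulComplex R).X 0) :
    (koszulComplex R).aug x = toTrivial R (ε R (toHomX R 0 x 1)) :=
  kEval_eq _ x

theorem d_d (i : ℕ) (x : (koszulComplex R).X (i + 2)) :
    (koszulComplex R).d i ((koszulComplex R).d (i + 1) x) = 0 := by
  apply toHomX_injective
  rw [toHomX_d, toHomX_d, ← Module.End.mul_apply, ← pow_add,
    gap_add_gap (inferInstance : Fact (2 ≤ N)).out, kdHom_pow_N, map_zero]

theorem aug_d (x : (koszulComplex R).X 1) :
    (koszulComplex R).aug ((koszulComplex R).d 0 x) = 0 :=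
  LinearMap.congr_fun (kEval_comp_kdIter R 0 0 ⟨1, one_mem_component (perp R)⟩) x

/-- The module basis of a term of the Koszul complex. -/
def basisX (R : Submodule k (⨂[k]^N V)) (i : ℕ) :
    Module.Basis (Fin (Module.finrank k (shriekComponent R (jump N i))))
      (HomogeneousAlgebra R) ((koszulComplex R).X i) :=
  Algebra.TensorProduct.basis (HomogeneousAlgebra R)
    (Module.finBasis k (shriekComponent R (jump N i))).dualBasis

theorem eq_sum_basisX (i : ℕ) (x : (koszulComplex R).X i) :
    x = ∑ w, toHomX R i x (Module.finBasis k (shriekComponent R (jump N i)) w) •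
      basisX R i w := by
  refine (eq_sum_toHom (Module.finBasis k (shriekComponent R (jump N i))) x).trans ?_
  refine Finset.sum_congr rfl fun w _ => ?_
  refine Eq.trans ?_ (Algebra.TensorProduct.basis_repr_symm_apply'
    (Module.finBasis k (shriekComponent R (jump N i))).dualBasis _ w).symm
  rw [Module.Basis.coe_dualBasis]
  rfl

variable (R) in
/-- The elements of `P_i` that are homogeneous of degree `s`, for the degree in the first factor of
`A ⊗ (A^!_{n(i)})^*`. -/
def IsHom {i : ℕ} (s : ℕ) (x : (koszulComplex R).X i) : Prop :=
  ∀ f, toHomX R i x f ∈ component R s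

theorem isHom_basisX (i : ℕ) (w : Fin (Module.finrank k (shriekComponent R (jump N i)))) :
    IsHom R 0 (basisX R i w) := by
  intro f
  have h : toHomX R i (basisX R i w) f =
      (Module.finBasis k (shriekComponent R (jump N i))).dualBasis w
        (projComponent R (jump N i) f) • (1 : HomogeneousAlgebra R) := by
    have h2 : basisX R i w = (1 : HomogeneousAlgebra R) ⊗ₜ[k]
      (Module.finBasis k (shriekComponent R (jump N i))).dualBasis w :=
      Algebra.TensorProduct.basis_apply _ w
    rw [h2]
    exact toHom_tmul _ _ _ _
  rw [h]
  exact Submodule.smul_mem _ _ (one_mem_component R)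

theorem IsHom.d {i s : ℕ} {x : (koszulComplex R).X (i + 1)} (hx : IsHom R s x) :
    IsHom R (s + gap N i) ((koszulComplex R).d i x) := by
  intro f
  rw [toHomX_d]
  exact kdHom_pow_mem_component hx f

variable (R) in
/-- The syzygies: the kernel of `P_i → P_{i-1}`, or of the augmentation if `i = 0`. -/
def syz : ∀ i : ℕ, Submodule (HomogeneousAlgebra R) ((koszulComplex R).X i)
  | 0 => LinearMap.ker (koszulComplex R).aug
  | i + 1 => LinearMap.ker ((koszulComplex R).d i)

theorem d_mem_syz (i : ℕ) (x : (koszulComplex R).X (i + 1)) :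
    (koszulComplex R).d i x ∈ syz R i := by
  cases i with
  | zero => exact aug_d x
  | succ i => exact d_d i x

instance projective_X (i : ℕ) : Module.Projective (HomogeneousAlgebra R) ((koszulComplex R).X i) :=
  Module.Projective.of_basis (basisX R i)

/-- A partial comparison of the Koszul complex with a graded resolution `Q` in degree `i`: a graded
map `α : P_i → Q_i`, a map `β : Q_i → P_i` and a map `t : P_i → Z_i` such that `β α = 1 + t` on the
syzygies `Z_i`, where `α` and `β` are compatible with syzygies. -/
def HasComparison (Q : GradedResolution R) (i : ℕ) : Prop :=
  ∃ (α : (koszulComplex R).X i →ₗ[HomogeneousAlgebra R] Q.X i)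
    (β : Q.X i →ₗ[HomogeneousAlgebra R] (koszulComplex R).X i)
    (t : (koszulComplex R).X i →ₗ[HomogeneousAlgebra R] (koszulComplex R).X i),
    (∀ (s : ℕ) (x : (koszulComplex R).X i), IsHom R s x → α x ∈ Q.deg i (s + jump N i : ℕ)) ∧
    (∀ z ∈ syz R i, α z ∈ LinearMap.range (Q.d i)) ∧ (∀ y, β (Q.d i y) ∈ syz R i) ∧
    (∀ x, t x ∈ syz R i) ∧ ∀ z ∈ syz R i, β (α z) = z + t z

/-- Lifting basis elements one by one controls degrees. A basis element of `P_i` has `A`-degree `0`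
and total degree `n(i)`, hence the shift by `jump N i`. -/
theorem exists_graded_lift (Q : GradedResolution R) (i j : ℕ) {W : Type*} [AddCommGroup W]
    [Module (HomogeneousAlgebra R) W] (D : Q.X j →ₗ[HomogeneousAlgebra R] W)
    (τ : (koszulComplex R).X i →ₗ[HomogeneousAlgebra R] W)
    (h : ∀ w, ∃ y ∈ Q.deg j (jump N i : ℕ), D y = τ (basisX R i w)) :
    ∃ α : (koszulComplex R).X i →ₗ[HomogeneousAlgebra R] Q.X j, D ∘ₗ α = τ ∧
      ∀ (s : ℕ) (x : (koszulComplex R).X i), IsHom R s x → α x ∈ Q.deg j (s + jump N i : ℕ) := by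
  choose y hy hD using h
  let α := (basisX R i).constr ℕ y
  have hα : ∀ w, α (basisX R i w) = y w := fun w => (basisX R i).constr_basis ℕ y w
  refine ⟨α, (basisX R i).ext fun w => ?_, fun s x hx => ?_⟩
  · rw [LinearMap.comp_apply, hα, hD]
  · rw [eq_sum_basisX i x, map_sum]
    refine AddSubgroup.sum_mem _ fun w _ => ?_
    rw [map_smul, hα, Nat.cast_add]
    exact Q.smul_mem j s _ _ _ (hx _) (hy w)

theorem aug_surjective : Function.Surjective (koszulComplex R).aug := by
  intro c
  let φ : KHom R := (ε (perp R)).toLinearMap.smulRight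
    ((toTrivial R).symm c • (1 : HomogeneousAlgebra R))
  obtain ⟨x, hx⟩ := exists_toHomX_eq (R := R) (i := 0) (φ := φ) (by
    intro L hL
    change ε (perp R) (dualMonom R L) • ((toTrivial R).symm c • (1 : HomogeneousAlgebra R)) = 0
    have hL' : L.length ≠ 0 := hL
    rw [ε_word, if_neg hL', zero_smul])
  refine ⟨x, ?_⟩
  rw [aug_apply, hx]
  simp [φ]

theorem hasComparison_zero (Q : GradedResolution R) : HasComparison Q 0 := by
  have hQ := Q.isProjectiveResolution
  obtain ⟨α, hα, hg⟩ := exists_graded_lift Q 0 0 Q.aug (koszulComplex R).aug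
    fun w => Q.exists_homogeneous_preimage_aug _
  have hα' : ∀ x, Q.aug (α x) = (koszulComplex R).aug x := LinearMap.congr_fun hα
  have hpr := hQ.projective 0
  obtain ⟨β, hβ⟩ := Module.projective_lifting_property (koszulComplex R).aug Q.aug aug_surjective
  have hβ' : ∀ x, (koszulComplex R).aug (β x) = Q.aug x := LinearMap.congr_fun hβ
  refine ⟨α, β, β ∘ₗ α - LinearMap.id, hg, ?_, ?_, ?_, ?_⟩
  · intro z hz
    have hz' : (koszulComplex R).aug z = 0 := hz
    exact (hQ.exact_zero (α z)).1 (by rw [hα', hz'])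
  · intro y
    change (koszulComplex R).aug (β (Q.d 0 y)) = 0
    rw [hβ', hQ.exact_zero.apply_apply_eq_zero]
  · intro x
    change (koszulComplex R).aug (β (α x) - x) = 0
    rw [map_sub, hβ', hα', sub_self]
  · intro z _
    simp

/-- The usual comparison argument, with exactness at `P_i` providing lifts of maps into the syzygies
`Z_i`. The correction `t` must be defined on all of `P_i`, not only on `Z_i`: this is what makes it
send `A₊ P_i` into `A₊ Z_i` in `mem_augSyz`. -/
theorem HasComparison.succ {Q : GradedResolution R} {i : ℕ} (h : HasComparison Q i)
    (hex : syz R i ≤ LinearMap.range ((koszulComplex R).d i)) : HasComparison Q (i + 1) := by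
  have hQ := Q.isProjectiveResolution
  obtain ⟨α, β, t, hg, hα, hβ, ht, hβα⟩ := h
  obtain ⟨α', hα', hg'⟩ := exists_graded_lift Q (i + 1) (i + 1) (Q.d i)
    (α ∘ₗ (koszulComplex R).d i) fun w => by
      apply Q.exists_homogeneous_preimage
      · have h := hg _ _ (isHom_basisX (i + 1) w).d
        rwa [zero_add, add_comm (gap N i)] at h
      · exact hα _ (d_mem_syz i _)
  have hα'' : ∀ x, Q.d i (α' x) = α ((koszulComplex R).d i x) := LinearMap.congr_fun hα'
  have hpr := hQ.projective (i + 1)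
  have lift : ∀ {W : Type (max u v)} [AddCommGroup W] [Module (HomogeneousAlgebra R) W]
      [Module.Projective (HomogeneousAlgebra R) W]
      (τ : W →ₗ[HomogeneousAlgebra R] (koszulComplex R).X i) (_ : ∀ x, τ x ∈ syz R i),
      ∃ σ : W →ₗ[HomogeneousAlgebra R] (koszulComplex R).X (i + 1),
        ∀ x, (koszulComplex R).d i (σ x) = τ x := by
    intro W _ _ _ τ hτ
    obtain ⟨σ, hσ⟩ := Module.projective_lifting_property ((koszulComplex R).d i).rangeRestrict
      (τ.codRestrict _ fun x => hex (hτ x)) (LinearMap.surjective_rangeRestrict _)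
    exact ⟨σ, fun x => congrArg Subtype.val (LinearMap.congr_fun hσ x)⟩
  obtain ⟨β', hβ'⟩ := lift (β ∘ₗ Q.d i) hβ
  obtain ⟨σ, hσ⟩ := lift t ht
  -- Here `σ` lifts the old `t` through `d`. Subtracting `σ d` cancels the term `t d` in `d(β' α' -
  -- 1)`, so the new `t` has values in syzygies, and it changes nothing on syzygies.
  refine ⟨α', β', β' ∘ₗ α' - LinearMap.id - σ ∘ₗ (koszulComplex R).d i, hg', ?_, ?_, ?_, ?_⟩
  · intro z hz
    have hz' : (koszulComplex R).d i z = 0 := hz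
    exact (hQ.exact_succ i (α' z)).1 (by rw [hα'', hz', map_zero])
  · intro y
    change (koszulComplex R).d i (β' (Q.d (i + 1) y)) = 0
    rw [hβ', LinearMap.comp_apply, (hQ.exact_succ i).apply_apply_eq_zero, map_zero]
  · intro x
    change (koszulComplex R).d i (β' (α' x) - x - σ ((koszulComplex R).d i x)) = 0
    rw [map_sub, map_sub, hβ', LinearMap.comp_apply, hα'', hβα _ (d_mem_syz i x), hσ]
    abel
  · intro z hz
    have hz' : (koszulComplex R).d i z = 0 := hz
    simp [hz']

variable (R) in
/-- The submodule `A₊ Z_i` of the module of syzygies `Z_i`. -/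
def augSyz (i : ℕ) : Submodule (HomogeneousAlgebra R) ((koszulComplex R).X i) :=
  Submodule.span _ {y | ∃ (a : HomogeneousAlgebra R) (z : (koszulComplex R).X i),
    ε R a = 0 ∧ z ∈ syz R i ∧ y = a • z}

/-- The values of `z` are scalars, and the differential displays them as coefficients of words of
length `gap N i < N`, which are independent in `A`. -/
theorem eq_zero_of_isHom_zero {i : ℕ} {z : (koszulComplex R).X (i + 1)} (hz : z ∈ syz R (i + 1))
    (hz0 : IsHom R 0 z) : z = 0 := by
  have hN := (inferInstance : Fact (2 ≤ N)).out
  apply toHomX_injective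
  rw [map_zero]
  refine kHom_ext (toHomX_mem (i + 1) z) (zero_mem _) fun L hL => ?_
  rw [jump_succ, add_comm] at hL
  have hg : gap N i < N := by
    unfold gap
    split_ifs <;> omega
  have h0 : (kdHom R ^ gap N i) (toHomX R (i + 1) z) = 0 := by
    rw [← toHomX_d, show (koszulComplex R).d i z = 0 from hz, map_zero]
  have h1 := LinearMap.congr_fun h0 (dualMonom R (L.drop (gap N i)))
  rw [kdHom_pow_apply, LinearMap.zero_apply] at h1
  have h2 : ∀ f, toHomX R (i + 1) z f = ε R (toHomX R (i + 1) z f) • 1 := fun f => by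
    rw [← proj_zero (Module.finBasis k V), proj_of_mem _ (hz0 f), if_pos rfl]
  have h3 := congrArg (wordCoord (Module.finBasis k V) (L.take (gap N i))) h1
  rw [map_zero] at h3
  have h4 := wordCoord_sum (S := R) (Module.finBasis k V) hg
    (fun w => ε R (toHomX R (i + 1) z (dualMonom R w * dualMonom R (L.drop (gap N i)))))
    (u := L.take (gap N i)) (by simp [hL])
  have h5 : ε R (toHomX R (i + 1) z (dualMonom R L)) = 0 := by
    rw [← h3]
    have h6 : dualMonom R L =
        dualMonom R (L.take (gap N i)) * dualMonom R (L.drop (gap N i)) := by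
      rw [← dualMonom_append, List.take_append_drop]
    conv_lhs => rw [h6]
    rw [← h4]
    congr 1
    refine Finset.sum_congr rfl fun w _ => ?_
    conv_rhs => rw [h2]
    rw [smul_mul_assoc, one_mul]
  rw [h2, h5, zero_smul, LinearMap.zero_apply]

/-- For `s > 0`, `z` lies in `A₊ P`, so `α z = d y` lies in `A₊ Q` and `y` is a Tor cycle. By
vanishing, `y` is a boundary plus some `u` in `A₊ Q`, and `α z = d u`. Hence `β α z = β d u` lies in
`A₊ Z`; so does `t z`, and `z = β α z - t z`. -/
theorem mem_augSyz {Q : GradedResolution R} {i : ℕ} (h : HasComparison Q (i + 1)) {s : ℕ}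
    (hTor : Subsingleton (Q.Tor (i + 2) (s + jump N (i + 1) : ℕ)))
    {z : (koszulComplex R).X (i + 1)} (hz : z ∈ syz R (i + 1)) (hs : IsHom R s z) :
    z ∈ augSyz R (i + 1) := by
  by_cases hs0 : s = 0
  · subst hs0
    rw [eq_zero_of_isHom_zero hz hs]
    exact zero_mem _
  obtain ⟨α, β, t, hg, hα, hβ, ht, hβα⟩ := h
  obtain ⟨y, hy, hyz⟩ := Q.exists_homogeneous_preimage (hg s z hs) (hα z hz)
  have hε : ∀ f, ε R (toHomX R (i + 1) z f) = 0 := fun f => ε_of_mem hs0 (hs f)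
  have hαz : α z ∈ Q.augMul (i + 1) := by
    rw [eq_sum_basisX (i + 1) z, map_sum]
    refine Submodule.sum_mem _ fun w _ =>
      Submodule.subset_span ⟨_, α (basisX R (i + 1) w),
        hε (Module.finBasis k (shriekComponent R (jump N (i + 1))) w), ?_⟩
    rw [map_smul]
  have hcyc : y ∈ Q.torCycles (i + 2) (s + jump N (i + 1) : ℕ) := by
    refine ⟨hy, ?_⟩
    change Q.d (i + 1) y ∈ Q.augMul (i + 1)
    rw [hyz]
    exact hαz
  have hbd : y ∈ Q.torBoundaries (i + 2) := by
    let c : Q.torCycles (i + 2) (s + jump N (i + 1) : ℕ) := ⟨y, hcyc⟩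
    have h1 := hTor.elim (QuotientAddGroup.mk (s := (Q.torBoundaries (i + 2)).addSubgroupOf
        (Q.torCycles (i + 2) (s + jump N (i + 1) : ℕ))) c) 0
    exact (QuotientAddGroup.eq_zero_iff c).1 h1
  obtain ⟨_, ⟨y', rfl⟩, u, hu, hyu⟩ := Submodule.mem_sup.1 hbd
  have hdu : Q.d (i + 1) u = α z := by
    rw [← hyz, ← hyu, map_add, (Q.isProjectiveResolution.exact_succ (i + 1)).apply_apply_eq_zero,
      zero_add]
  have hle : Q.augMul (i + 2) ≤ (augSyz R (i + 1)).comap (β ∘ₗ Q.d (i + 1)) := by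
    refine Submodule.span_le.2 ?_
    rintro _ ⟨a, x, ha, rfl⟩
    refine Submodule.subset_span ⟨a, β (Q.d (i + 1) x), ha, hβ x, ?_⟩
    rw [map_smul]
    rfl
  have h1 : β (α z) ∈ augSyz R (i + 1) := by
    rw [← hdu]
    exact hle hu
  have h2 : t z ∈ augSyz R (i + 1) := by
    rw [eq_sum_basisX (i + 1) z, map_sum]
    refine Submodule.sum_mem _ fun w _ =>
      Submodule.subset_span ⟨_, t (basisX R (i + 1) w),
        hε (Module.finBasis k (shriekComponent R (jump N (i + 1))) w), ht _, ?_⟩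
    rw [map_smul]
  rw [hβα z hz] at h1
  simpa using sub_mem h1 h2

end Complex

/-! ### Exactness of the Koszul complex by graded Nakayama. -/

section Exactness

variable {k : Type u} [Field k] {V : Type v} [AddCommGroup V] [Module k V]
  [FiniteDimensional k V] {N : ℕ} {R : Submodule k (⨂[k]^N V)}

variable (R) in
/-- The projection of linear maps `A^! → A` to their homogeneous part of degree `s` in `A`. -/
def projHom (s : ℕ) : KHom R →ₗ[k] KHom R where
  toFun φ := proj R (Module.finBasis k V) s ∘ₗ φ
  map_add' _ _ := LinearMap.comp_add _ _ _
  map_smul' _ _ := LinearMap.comp_smul _ _ _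

theorem projHom_apply (s : ℕ) (φ : KHom R) (f : Shriek R) :
    projHom R s φ f = proj R (Module.finBasis k V) s (φ f) := rfl

theorem projHom_mem {m : ℕ} (s : ℕ) {φ : KHom R} (hφ : φ ∈ KDeg R m) : projHom R s φ ∈ KDeg R m := by
  intro L hL
  rw [projHom_apply, hφ L hL, map_zero]

theorem projHom_of_mem {s : ℕ} {φ : KHom R} (hφ : ∀ f, φ f ∈ component R s) :
    projHom R s φ = φ := by
  ext f
  rw [projHom_apply, proj_of_mem _ (hφ f), if_pos rfl]

theorem kdHom_pow_projHom (p s : ℕ) (φ : KHom R) :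
    (kdHom R ^ p) (projHom R s φ) = projHom R (s + p) ((kdHom R ^ p) φ) := by
  ext f
  rw [kdHom_pow_apply, projHom_apply, kdHom_pow_apply, map_sum]
  refine Finset.sum_congr rfl fun L hL => ?_
  rw [mem_words] at hL
  subst hL
  rw [proj_mul_of_mem _ (word_mem_component _ L), projHom_apply]

theorem projHom_smul (s : ℕ) (a : HomogeneousAlgebra R) (φ : KHom R) :
    projHom R s (a • φ) = ∑ pq ∈ Finset.HasAntidiagonal.antidiagonal s,
      proj R (Module.finBasis k V) pq.1 a • projHom R pq.2 φ := by
  ext f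
  rw [projHom_apply, LinearMap.smul_apply, smul_eq_mul, proj_mul, LinearMap.sum_apply]
  rfl

theorem exists_sum_projHom {m : ℕ} {φ : KHom R} (hφ : φ ∈ KDeg R m) :
    ∃ M, φ = ∑ s ∈ Finset.range M, projHom R s φ := by
  choose M hM using fun L => exists_sum_proj (Module.finBasis k V) (φ (dualMonom R L))
  refine ⟨(words _ m).sup M, kHom_ext hφ (Submodule.sum_mem _ fun s _ => projHom_mem s hφ) ?_⟩
  intro L hL
  rw [LinearMap.sum_apply]
  simp only [projHom_apply]
  rw [hM L _ (Finset.le_sup (f := M) (mem_words.2 hL))]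

variable [Fact (2 ≤ N)]

/-- Induction on the `A`-degree `s` of a homogeneous syzygy. Outside the critical degree it lies in
`A₊ Z`, and the part of degree `s` of a product `a x` with `ε a = 0` involves only the parts of `x`
of degree less than `s`, which are again syzygies. The critical degree is left to `hker`. -/
theorem syz_le_range_of_homogeneous {i : ℕ}
    (hsyz : ∀ (s : ℕ) (z : (koszulComplex R).X (i + 1)), z ∈ syz R (i + 1) → IsHom R s z →
      s ≠ gap N (i + 1) → z ∈ augSyz R (i + 1))
    (hker : ∀ φ ∈ KDeg R (jump N (i + 1)), (∀ f, φ f ∈ component R (gap N (i + 1))) →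
      (kdHom R ^ gap N i) φ = 0 →
        ∃ ψ ∈ KDeg R (jump N (i + 1) + gap N (i + 1)), (kdHom R ^ gap N (i + 1)) ψ = φ) :
    syz R (i + 1) ≤ LinearMap.range ((koszulComplex R).d (i + 1)) := by
  let I : Submodule (HomogeneousAlgebra R) (KHom R) :=
    (KDeg R (jump N (i + 1) + gap N (i + 1))).map (kdHom R ^ gap N (i + 1))
  have hom : ∀ (s : ℕ) (φ : KHom R), φ ∈ KDeg R (jump N (i + 1)) → (∀ f, φ f ∈ component R s) →
      (kdHom R ^ gap N i) φ = 0 → φ ∈ I := by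
    intro s
    induction s using Nat.strong_induction_on with
    | _ s ih =>
      intro φ hm hs h0
      by_cases hsg : s = gap N (i + 1)
      · subst hsg
        exact hker φ hm hs h0
      obtain ⟨z, rfl⟩ := exists_toHomX_eq hm
      have hz : z ∈ syz R (i + 1) := by
        change (koszulComplex R).d i z = 0
        apply toHomX_injective
        rw [toHomX_d, h0, map_zero]
      have haug := hsyz s z hz hs hsg
      have key : ∀ y ∈ augSyz R (i + 1), projHom R s (toHomX R (i + 1) y) ∈ I := by
        intro y hy
        -- `projHom R s` is not `A`-linear, so closure under scalars cannot be an induction step;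
        -- the scalars are absorbed into the generators instead.
        refine Submodule.closure_induction (p := fun y _ => projHom R s (toHomX R (i + 1) y) ∈ I)
          ?_ ?_ ?_ hy
        · rw [map_zero, map_zero]
          exact zero_mem _
        · intro x y _ _ hx hy
          rw [map_add, map_add]
          exact add_mem hx hy
        · rintro c _ ⟨a, x, ha, hx, rfl⟩
          have hx' : (kdHom R ^ gap N i) (toHomX R (i + 1) x) = 0 := by
            rw [← toHomX_d, show (koszulComplex R).d i x = 0 from hx, map_zero]
          rw [smul_smul, map_smul, projHom_smul]
          refine Submodule.sum_mem _ ?_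
          rintro ⟨p, q⟩ hpq
          rw [Finset.HasAntidiagonal.mem_antidiagonal] at hpq
          simp only at hpq ⊢
          by_cases hp : p = 0
          · rw [hp, proj_zero, map_mul, ha, mul_zero, zero_smul, zero_smul]
            exact zero_mem _
          · refine Submodule.smul_mem _ _ (ih q (by omega) _ (projHom_mem q (toHomX_mem _ x))
              (fun f => proj_mem _ q _) ?_)
            rw [kdHom_pow_projHom, hx', map_zero]
      rw [← projHom_of_mem hs]
      exact key z haug
  intro z hz
  have hz' : (kdHom R ^ gap N i) (toHomX R (i + 1) z) = 0 := by
    rw [← toHomX_d, show (koszulComplex R).d i z = 0 from hz, map_zero]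
  have hI : toHomX R (i + 1) z ∈ I := by
    obtain ⟨M, hM⟩ := exists_sum_projHom (toHomX_mem (i + 1) z)
    rw [hM]
    refine Submodule.sum_mem _ fun s _ => hom s _ (projHom_mem s (toHomX_mem _ z))
      (fun f => proj_mem _ s _) ?_
    rw [kdHom_pow_projHom, hz', map_zero]
  obtain ⟨ψ, hψ, hψz⟩ := hI
  obtain ⟨x, rfl⟩ := exists_toHomX_eq (i := i + 2) hψ
  exact ⟨x, toHomX_injective _ (by rw [toHomX_d, hψz])⟩

theorem syz_zero_le_range : syz R 0 ≤ LinearMap.range ((koszulComplex R).d 0) := by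
  intro z hz
  have h : ε R (toHomX R 0 z 1) = 0 := by
    have h1 : (koszulComplex R).aug z = 0 := hz
    rw [aug_apply] at h1
    exact (toTrivial R).injective (by rw [h1, map_zero])
  obtain ⟨ψ, hψ, hψz⟩ := exists_kdHom_eq_zero (toHomX_mem 0 z) h
  obtain ⟨x, rfl⟩ := exists_toHomX_eq (i := 1) hψ
  exact ⟨x, toHomX_injective _ (by rw [toHomX_d, ← hψz]; exact congrFun (congrArg _ (pow_one _)) _)⟩

theorem syz_one_le_range : syz R 1 ≤ LinearMap.range ((koszulComplex R).d 1) := by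
  have hN := (inferInstance : Fact (2 ≤ N)).out
  intro z hz
  have h : kdHom R (toHomX R 1 z) = 0 := by
    have h1 := toHomX_d 0 z
    rw [show (koszulComplex R).d 0 z = 0 from hz, map_zero] at h1
    exact h1.symm
  obtain ⟨ψ, hψ, hψz⟩ := exists_kdHom_pow_eq_one (by omega) (toHomX_mem 1 z) h
  obtain ⟨x, rfl⟩ := exists_toHomX_eq (R := R) (i := 2) (φ := ψ) (by
    have h2 : jump N 2 = N := by simpa using (jump_even_odd (by omega : 1 ≤ N) 1).1
    rwa [h2])
  exact ⟨x, toHomX_injective _ (by rw [toHomX_d, ← hψz]; rfl)⟩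

omit [FiniteDimensional k V] in
theorem subsingleton_tor {Q : GradedResolution R}
    (hQ : ∀ i : ℕ, 3 ≤ i → ∀ m : ℤ, m ≠ jump N i → Subsingleton (Q.Tor i m)) {i s : ℕ}
    (hi : 1 ≤ i) (hs : s ≠ gap N (i + 1)) :
    Subsingleton (Q.Tor (i + 2) (s + jump N (i + 1) : ℕ)) := by
  refine hQ (i + 2) (by omega) _ ?_
  rw [jump_succ N (i + 1)]
  norm_cast
  omega

theorem syz_le_range_of_even {Q : GradedResolution R}
    (hQ : ∀ i : ℕ, 3 ≤ i → ∀ m : ℤ, m ≠ jump N i → Subsingleton (Q.Tor i m)) {i : ℕ}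
    (hi : Odd i) (hc : HasComparison Q (i + 1)) :
    syz R (i + 1) ≤ LinearMap.range ((koszulComplex R).d (i + 1)) := by
  have hN := (inferInstance : Fact (2 ≤ N)).out
  have h1 : gap N (i + 1) = 1 := if_pos (by simpa [Nat.even_add_one] using hi)
  have h2 : gap N i = N - 1 := if_neg (by simpa using hi)
  refine syz_le_range_of_homogeneous (fun s z hz hs hsg =>
    mem_augSyz hc (subsingleton_tor hQ hi.pos hsg) hz hs) fun φ hm hs h0 => ?_
  rw [h1] at hs ⊢
  rw [h2] at h0
  rw [pow_one]
  exact exists_kdHom_eq (by omega) (by omega) hm hs h0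

theorem syz_le_range_of_odd {Q : GradedResolution R}
    (hQ : ∀ i : ℕ, 3 ≤ i → ∀ m : ℤ, m ≠ jump N i → Subsingleton (Q.Tor i m)) {i : ℕ}
    (hi : Even i) (hi2 : 2 ≤ i) (hR : ExtraCondition R) (hc : HasComparison Q (i + 1)) :
    syz R (i + 1) ≤ LinearMap.range ((koszulComplex R).d (i + 1)) := by
  have hN := (inferInstance : Fact (2 ≤ N)).out
  have h1 : gap N (i + 1) = N - 1 := if_neg (by simpa [Nat.even_add_one] using hi)
  have h2 : gap N i = 1 := if_pos hi
  refine syz_le_range_of_homogeneous (fun s z hz hs hsg =>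
    mem_augSyz hc (subsingleton_tor hQ (by omega) hsg) hz hs) fun φ hm hs h0 => ?_
  rw [h1] at hs ⊢
  rw [h2, pow_one] at h0
  refine hR.exists_kdHom_pow_eq (by omega) ?_ hm hs h0
  obtain ⟨q, hq⟩ := hi
  have h3 := (jump_even_odd (by omega : 1 ≤ N) q).2
  rw [show i + 1 = 2 * q + 1 by omega, h3]
  have : 1 * N ≤ q * N := Nat.mul_le_mul_right N (by omega)
  omega

theorem extraCondition_of_syz (h : syz R 2 ≤ LinearMap.range ((koszulComplex R).d 2)) :
    ExtraCondition R := by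
  have hN := (inferInstance : Fact (2 ≤ N)).out
  have h2 : jump N 2 = N := by simpa using (jump_even_odd (by omega : 1 ≤ N) 1).1
  refine extraCondition_of_exact (by omega) fun φ hm h0 => ?_
  obtain ⟨z, rfl⟩ := exists_toHomX_eq (R := R) (i := 2) (φ := φ) (by rwa [h2])
  have hz : z ∈ syz R 2 := by
    change (koszulComplex R).d 1 z = 0
    apply toHomX_injective
    rw [toHomX_d, map_zero, ← h0]
    rfl
  obtain ⟨x, rfl⟩ := h hz
  refine ⟨toHomX R 3 x, ?_, ?_⟩
  · have h3 := toHomX_mem 3 x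
    rwa [jump_succ, h2] at h3
  · rw [toHomX_d]
    exact congrFun (congrArg _ (pow_one _).symm) _

/-- The order matters. Exactness at `P_0` and `P_1` is unconditional; exactness at `P_2`, where the
critical degree is `1`, follows from `Tor_3` without the extra condition, and then yields that
condition for all later odd terms. -/
theorem syz_le_range (hR : IsKoszul R) (i : ℕ) :
    syz R i ≤ LinearMap.range ((koszulComplex R).d i) := by
  obtain ⟨Q, hQ⟩ := hR
  have c2 : HasComparison Q 2 :=
    ((hasComparison_zero Q).succ syz_zero_le_range).succ syz_one_le_range
  have e2 := syz_le_range_of_even hQ odd_one c2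
  have hE := extraCondition_of_syz e2
  have h : ∀ i, HasComparison Q (i + 2) ∧
      syz R (i + 2) ≤ LinearMap.range ((koszulComplex R).d (i + 2)) := by
    intro i
    induction i with
    | zero => exact ⟨c2, e2⟩
    | succ i ih =>
      have hc := ih.1.succ ih.2
      refine ⟨hc, ?_⟩
      rcases Nat.even_or_odd (i + 2) with he | ho
      · exact syz_le_range_of_odd hQ he (by omega) hE hc
      · exact syz_le_range_of_even hQ ho hc
  match i with
  | 0 => exact syz_zero_le_range
  | 1 => exact syz_one_le_range
  | i + 2 => exact (h i).2

theorem koszulComplex_isProjectiveResolution (hR : IsKoszul R) :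
    (koszulComplex R).IsProjectiveResolution where
  projective i := projective_X i
  aug_surjective := aug_surjective
  exact_zero x := ⟨fun h => syz_le_range hR 0 h, by
    rintro ⟨y, rfl⟩
    exact aug_d y⟩
  exact_succ i x := ⟨fun h => syz_le_range hR (i + 1) h, by
    rintro ⟨y, rfl⟩
    exact d_d i y⟩

end Exactness

/-! ### The action of `A^!` on the Koszul `N`-complex. -/

section RightMul

variable {k : Type u} [Field k] {V : Type v} [AddCommGroup V] [Module k V]
  [FiniteDimensional k V] {N : ℕ} {R : Submodule k (⨂[k]^N V)}

variable (R) in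
/-- Precomposition with the right multiplication by an element of `A^!`. -/
def rightMul (g : Shriek R) : KHom R →ₗ[HomogeneousAlgebra R] KHom R where
  toFun φ := φ ∘ₗ LinearMap.mulRight k g
  map_add' _ _ := rfl
  map_smul' _ _ := rfl

omit [FiniteDimensional k V] in
theorem rightMul_apply (g : Shriek R) (φ : KHom R) (f : Shriek R) :
    rightMul R g φ f = φ (f * g) := rfl

/-- Left and right multiplications in `A^!` commute, and the differential uses only left ones. -/
theorem rightMul_kdHom_pow (g : Shriek R) (p : ℕ) (φ : KHom R) :
    rightMul R g ((kdHom R ^ p) φ) = (kdHom R ^ p) (rightMul R g φ) := by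
  ext f
  rw [rightMul_apply, kdHom_pow_apply, kdHom_pow_apply]
  refine Finset.sum_congr rfl fun L _ => ?_
  rw [rightMul_apply, mul_assoc]

theorem rightMul_mem {m n : ℕ} {g : Shriek R} (hg : g ∈ shriekComponent R n) {φ : KHom R}
    (hφ : φ ∈ KDeg R (m + n)) : rightMul R g φ ∈ KDeg R m := by
  intro L hL
  rw [rightMul_apply]
  exact apply_eq_zero_of_mem hφ (mul_mem_component (word_mem_component _ L) hg) (by omega)

end RightMul

/-! ### The Ext spaces and the Yoneda product. -/

section Yoneda

variable {k : Type u} [Field k] {V : Type v} [AddCommGroup V] [Module k V]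
  [FiniteDimensional k V] {N : ℕ} {R : Submodule k (⨂[k]^N V)} [Fact (2 ≤ N)]

variable (R) in
/-- The cocycle `a ⊗ α ↦ ε(a) ⟨α, f⟩`, as a linear map on a term of the Koszul complex. -/
def cocycle (i : ℕ) (f : shriekComponent R (jump N i)) :
    (koszulComplex R).X i →ₗ[HomogeneousAlgebra R] Trivial R := kEval R (jump N i) f

theorem cocycle_apply (i : ℕ) (f : shriekComponent R (jump N i)) (x : (koszulComplex R).X i) :
    cocycle R i f x = toTrivial R (ε R (toHomX R i x f)) := kEval_eq f x

theorem cocycle_comp_d (i : ℕ) (f : shriekComponent R (jump N i)) :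
    cocycle R i f ∘ₗ (koszulComplex R).d i = 0 := by
  obtain ⟨p, hp⟩ := Nat.exists_eq_succ_of_ne_zero
    (gap_pos (inferInstance : Fact (2 ≤ N)).out i).ne'
  change kEval R (jump N i) f ∘ₗ kdIter R (jump N i) (gap N i) = 0
  rw [hp]
  exact kEval_comp_kdIter R _ p f

theorem cocycle_mem (i : ℕ) (f : shriekComponent R (jump N i)) :
    cocycle R i f ∈ (koszulComplex R).cocycles k i := cocycle_comp_d i f

theorem toE_apply (i : ℕ) (f : shriekComponent R (jump N i)) :
    toE R i f = (koszulComplex R).extMk k i ⟨cocycle R i f, cocycle_mem i f⟩ := rfl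

theorem exists_cocycle_eq (i : ℕ)
    (g : (koszulComplex R).X i →ₗ[HomogeneousAlgebra R] Trivial R) : ∃ f, cocycle R i f = g := by
  let β := Module.finBasis k (shriekComponent R (jump N i))
  refine ⟨∑ w, (toTrivial R).symm (g (basisX R i w)) • β w, (basisX R i).ext fun w => ?_⟩
  have h : ∀ w' : Fin _, toHomX R i (basisX R i w) (β w') =
      if w' = w then (1 : HomogeneousAlgebra R) else 0 := by
    intro w'
    have h2 : basisX R i w = (1 : HomogeneousAlgebra R) ⊗ₜ[k] β.dualBasis w :=
      Algebra.TensorProduct.basis_apply _ w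
    rw [h2]
    refine (toHom_tmul _ _ _ _).trans ?_
    rw [projComponent_coe, Module.Basis.dualBasis_apply_self]
    split_ifs <;> simp
  rw [cocycle_apply, Submodule.coe_sum, map_sum, map_sum]
  simp only [Submodule.coe_smul, map_smul, h]
  rw [Finset.sum_eq_single w]
  · rw [if_pos rfl, map_one, smul_eq_mul, mul_one]
    exact (toTrivial R).apply_symm_apply _
  · intro w' _ hne
    rw [if_neg hne, map_zero, smul_zero]
  · simp

theorem cocycle_injective (i : ℕ) : Function.Injective (cocycle R i) := by
  have h : ∀ f, cocycle R i f = 0 → f = 0 := by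
    intro f hf
    apply (Module.forall_dual_apply_eq_zero_iff k f).1
    intro α
    have h1 := LinearMap.congr_fun hf ((1 : HomogeneousAlgebra R) ⊗ₜ[k] α)
    have h2 : cocycle R i f ((1 : HomogeneousAlgebra R) ⊗ₜ[k] α) =
      toTrivial R (ε R 1 * α f) := kEval_tmul _ _ _ _ _
    rw [h2, map_one, one_mul] at h1
    exact (toTrivial R).injective (h1.trans (map_zero _).symm)
  intro f g hfg
  rw [← sub_eq_zero]
  apply h
  have : cocycle R i (f - g) = cocycle R i f - cocycle R i g := by
    rw [eq_sub_iff_add_eq]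
    exact (kEval_add R _ _ _).symm.trans (congrArg _ (sub_add_cancel f g))
  rw [this, hfg, sub_self]

/-- Every `A`-linear map `P_i → k` is the cocycle of a unique `f`. So each map is a cocycle, and
each coboundary is a cocycle of this form composed with the differential, hence zero. -/
theorem toE_bijective (i : ℕ) : Function.Bijective (toE R i) := by
  constructor
  · intro f g hfg
    rw [toE_apply, toE_apply, AugmentedSequence.extMk_eq_iff] at hfg
    have h : cocycle R i f - cocycle R i g = 0 := by
      cases i with
      | zero => exact hfg
      | succ i =>
        obtain ⟨c, hc⟩ := hfg
        obtain ⟨e, rfl⟩ := exists_cocycle_eq i c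
        rw [cocycle_comp_d] at hc
        exact hc
    exact cocycle_injective i (sub_eq_zero.1 h)
  · intro z
    obtain ⟨g, rfl⟩ := Submodule.mkQ_surjective _ z
    obtain ⟨f, hf⟩ := exists_cocycle_eq i g.1
    exact ⟨f, by rw [toE_apply]; exact congrArg _ (Subtype.ext hf)⟩

/-- The difference is `N - 2` if both indices are odd and `0` otherwise. Being nonnegative, it can
serve as the exponent of `d` in `exists_isLift`, where the subtraction of natural numbers is then
exact. -/
theorem jump_add_le {N : ℕ} (hN : 2 ≤ N) (i j : ℕ) : jump N i + jump N j ≤ jump N (i + j) := by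
  have H := fun q => jump_even_odd (by omega : 1 ≤ N) q
  rcases Nat.even_or_odd' i with ⟨p, rfl | rfl⟩ <;> rcases Nat.even_or_odd' j with ⟨q, rfl | rfl⟩
  · rw [← mul_add, (H _).1, (H _).1, (H _).1, add_mul]
  · rw [← add_assoc, ← mul_add, (H _).1, (H _).2, (H _).2, add_mul, add_assoc]
  · rw [show 2 * p + 1 + 2 * q = 2 * (p + q) + 1 by ring, (H _).1, (H _).2, (H _).2, add_mul]
    omega
  · rw [show 2 * p + 1 + (2 * q + 1) = 2 * (p + q + 1) by ring, (H _).1, (H _).2, (H _).2, add_mul,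
      add_mul]
    omega

theorem jump_add {N : ℕ} (hN : 2 ≤ N) {i j : ℕ} (h : N = 2 ∨ Even i ∨ Even j) :
    jump N (i + j) = jump N i + jump N j := by
  have H := fun q => jump_even_odd (by omega : 1 ≤ N) q
  rcases Nat.even_or_odd' i with ⟨p, rfl | rfl⟩ <;> rcases Nat.even_or_odd' j with ⟨q, rfl | rfl⟩
  · rw [← mul_add, (H _).1, (H _).1, (H _).1, add_mul]
  · rw [← add_assoc, ← mul_add, (H _).1, (H _).2, (H _).2, add_mul, add_assoc]
  · rw [show 2 * p + 1 + 2 * q = 2 * (p + q) + 1 by ring, (H _).1, (H _).2, (H _).2, add_mul]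
    omega
  · have hN2 : N = 2 := by
      rcases h with h | h | h
      · exact h
      · simp at h
      · simp at h
    rw [show 2 * p + 1 + (2 * q + 1) = 2 * (p + q + 1) by ring, (H _).1, (H _).2, (H _).2, hN2]
    omega

theorem jump_add_lt {N : ℕ} (hN : 2 < N) {i j : ℕ} (hi : Odd i) (hj : Odd j) :
    jump N i + jump N j < jump N (i + j) := by
  have H := fun q => jump_even_odd (by omega : 1 ≤ N) q
  obtain ⟨p, rfl⟩ := hi
  obtain ⟨q, rfl⟩ := hj
  rw [show 2 * p + 1 + (2 * q + 1) = 2 * (p + q + 1) by ring, (H _).1, (H _).2, (H _).2, add_mul,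
      add_mul]
  omega

/-- The lift of the cocycle of `g` to a cycle of `Hom_A(P, P)`: up to sign, its components are
`d^c` composed with the action of `g`. -/
theorem exists_isLift (j : ℕ) (g : shriekComponent R (jump N j)) :
    ∃ g' : ∀ m l : ℕ, l + j = m →
        ((koszulComplex R).X m →ₗ[HomogeneousAlgebra R] (koszulComplex R).X l),
      (koszulComplex R).IsLift (cocycle R j g) g' ∧
      ∀ (m l : ℕ) (h : l + j = m) (x : (koszulComplex R).X m), toHomX R l (g' m l h x) =
        (-1 : ℤ) ^ (j * l) • (kdHom R ^ (jump N m - jump N l - jump N j))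
          (rightMul R (g : Shriek R) (toHomX R m x)) := by
  have hN := (inferInstance : Fact (2 ≤ N)).out
  have hex : ∀ (m l : ℕ) (_ : l + j = m),
      ∃ T : (koszulComplex R).X m →ₗ[HomogeneousAlgebra R] (koszulComplex R).X l,
      ∀ x, toHomX R l (T x) = (-1 : ℤ) ^ (j * l) •
        (kdHom R ^ (jump N m - jump N l - jump N j))
          (rightMul R (g : Shriek R) (toHomX R m x)) := by
    intro m l h
    have hle := jump_add_le hN l j
    rw [h] at hle
    obtain ⟨T, hT⟩ := exists_restrict (R := R) (m := jump N m) (n := jump N l)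
      ((-1 : ℤ) ^ (j * l) • ((kdHom R ^ (jump N m - jump N l - jump N j)) ∘ₗ
        rightMul R (g : Shriek R))) (by
        intro φ hφ
        change (-1 : ℤ) ^ (j * l) • (kdHom R ^ (jump N m - jump N l - jump N j))
          (rightMul R (g : Shriek R) φ) ∈ _
        refine zsmul_mem (kdHom_pow_mem (rightMul_mem g.2 ?_)) _
        rwa [show jump N l + (jump N m - jump N l - jump N j) + jump N j = jump N m by omega])
    exact ⟨T, hT⟩
  choose g' hg' using hex
  have hpow : ∀ (p q : ℕ) (φ : KHom R),
      (kdHom R ^ p) ((kdHom R ^ q) φ) = (kdHom R ^ (p + q)) φ := fun p q φ => by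
    rw [pow_add]
    rfl
  refine ⟨g', ⟨?_, ?_⟩, hg'⟩
  · intro m l h
    ext x
    apply toHomX_injective
    have hle := jump_add_le hN l j
    have hle' := jump_add_le hN (l + 1) j
    rw [show l + 1 + j = m + 1 by omega] at hle'
    rw [h] at hle
    rw [LinearMap.comp_apply, LinearMap.smul_apply, LinearMap.comp_apply, toHomX_d, hg',
      map_zsmul, map_zsmul, hg', toHomX_d, rightMul_kdHom_pow, hpow, hpow, smul_smul,
      ← pow_add]
    -- Both sides equal `n(m+1) - n(l) - n(j)`.
    have e1 : gap N l + (jump N (m + 1) - jump N (l + 1) - jump N j) =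
        jump N m - jump N l - jump N j + gap N m := by
      rw [jump_succ, jump_succ] at *
      omega
    rw [e1, show j * (l + 1) = j + j * l by ring]
  · ext x
    rw [LinearMap.comp_apply, aug_apply, hg', cocycle_apply]
    have h0 : jump N j - jump N 0 - jump N j = 0 := by
      rw [show jump N 0 = 0 from rfl]
      omega
    rw [h0, mul_zero, pow_zero, pow_zero, one_smul, Module.End.one_apply, rightMul_apply, one_mul]

/-- With exponent `0` the lift is `(-1)^{ij}` times the action of `g`, and evaluation at `f` becomes
evaluation at `fg`. With a positive exponent the composite vanishes. -/
theorem cocycle_comp_lift {i j : ℕ} (f : shriekComponent R (jump N i))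
    (g : shriekComponent R (jump N j))
    {T : (koszulComplex R).X (i + j) →ₗ[HomogeneousAlgebra R] (koszulComplex R).X i}
    (hT : ∀ x, toHomX R i (T x) =
        (-1 : ℤ) ^ (j * i) • (kdHom R ^ (jump N (i + j) - jump N i - jump N j))
          (rightMul R (g : Shriek R) (toHomX R (i + j) x)))
    (h : shriekComponent R (jump N (i + j)))
    (hh : (jump N (i + j) = jump N i + jump N j ∧
        (h : Shriek R) = (-1) ^ (i * j) * ((f : Shriek R) * g)) ∨
      (jump N i + jump N j < jump N (i + j) ∧ h = 0)) :
    cocycle R (i + j) h = cocycle R i f ∘ₗ T := by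
  ext x
  rw [LinearMap.comp_apply, cocycle_apply, cocycle_apply, hT]
  congr 1
  rcases hh with ⟨h1, h2⟩ | ⟨h1, rfl⟩
  · rw [h2, show jump N (i + j) - jump N i - jump N j = 0 by omega, pow_zero,
      Module.End.one_apply, LinearMap.smul_apply, rightMul_apply, mul_comm i j]
    rcases neg_one_pow_eq_or ℤ (j * i) with h3 | h3 <;>
    rcases Nat.even_or_odd (j * i) with h4 | h4 <;>
    simp_all [h4.neg_one_pow]
  -- At least one `d` is applied last, so each value is a sum of terms ending in a generator, which
  -- `ε` kills.
  · obtain ⟨c, hc⟩ : ∃ c, jump N (i + j) - jump N i - jump N j = c + 1 :=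
      ⟨jump N (i + j) - jump N i - jump N j - 1, by omega⟩
    rw [hc, pow_succ', Module.End.mul_apply, LinearMap.smul_apply, kdHom_apply,
      Submodule.coe_zero, map_zero, map_zero, map_zsmul, map_sum, Finset.sum_eq_zero, smul_zero]
    intro l _
    rw [map_mul, ε_ι, mul_zero]

theorem yonedaMul_toE (hP : (koszulComplex R).IsProjectiveResolution) {i j : ℕ}
    (f : shriekComponent R (jump N i)) (g : shriekComponent R (jump N j))
    (h : shriekComponent R (jump N (i + j)))
    (hh : (jump N (i + j) = jump N i + jump N j ∧
        (h : Shriek R) = (-1) ^ (i * j) * ((f : Shriek R) * g)) ∨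
      (jump N i + jump N j < jump N (i + j) ∧ h = 0)) :
    hP.yonedaMul k (toE R i f) (toE R j g) = toE R (i + j) h := by
  refine (hP.yonedaMul_eq_iff k _ _ _).2 ?_
  obtain ⟨g', hg', hT⟩ := exists_isLift j g
  exact ⟨⟨cocycle R i f, cocycle_mem i f⟩, ⟨cocycle R j g, cocycle_mem j g⟩,
    ⟨cocycle R (i + j) h, cocycle_mem (i + j) h⟩, g', hg',
    cocycle_comp_lift f g (hT (i + j) i rfl) h hh, rfl, rfl, rfl⟩

end Yoneda

end HomogeneousAlgebra

end

theorem proposition3p1 {k : Type u} [Field k] {V : Type v} [AddCommGroup V] [Module k V]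
    [FiniteDimensional k V] {N : ℕ} [Fact (2 ≤ N)] (R : Submodule k (⨂[k]^N V))
    (hR : HomogeneousAlgebra.IsKoszul R) :
    ∃ hP : (HomogeneousAlgebra.koszulComplex R).IsProjectiveResolution,
      (∀ i : ℕ, Function.Bijective (HomogeneousAlgebra.toE R i)) ∧
      ∀ (i j : ℕ) (f : HomogeneousAlgebra.shriekComponent R (HomogeneousAlgebra.jump N i))
        (g : HomogeneousAlgebra.shriekComponent R (HomogeneousAlgebra.jump N j)),
        (N = 2 ∨ 2 < N ∧ (Even i ∨ Even j) →
          ∃ h : HomogeneousAlgebra.shriekComponent R (HomogeneousAlgebra.jump N (i + j)),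
            (h : HomogeneousAlgebra.Shriek R) =
              (-1) ^ (i * j) * ((f : HomogeneousAlgebra.Shriek R) * g) ∧
            hP.yonedaMul k (HomogeneousAlgebra.toE R i f) (HomogeneousAlgebra.toE R j g) =
              HomogeneousAlgebra.toE R (i + j) h) ∧
        (2 < N → Odd i → Odd j →
          hP.yonedaMul k (HomogeneousAlgebra.toE R i f) (HomogeneousAlgebra.toE R j g) = 0) := by
  have hN := (inferInstance : Fact (2 ≤ N)).out
  refine ⟨HomogeneousAlgebra.koszulComplex_isProjectiveResolution hR,
    HomogeneousAlgebra.toE_bijective, fun i j f g => ⟨fun h => ?_, fun h2 hi hj => ?_⟩⟩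
  · have hj := HomogeneousAlgebra.jump_add hN (i := i) (j := j)
      (h.imp_right fun h => h.2)
    have hmem : (-1) ^ (i * j) * ((f : HomogeneousAlgebra.Shriek R) * g) ∈
        HomogeneousAlgebra.shriekComponent R (HomogeneousAlgebra.jump N (i + j)) := by
      have hfg := HomogeneousAlgebra.mul_mem_component f.2 g.2
      rw [← hj] at hfg
      rcases neg_one_pow_eq_or (HomogeneousAlgebra.Shriek R) (i * j) with h3 | h3
      · rwa [h3, one_mul]
      · rw [h3, neg_one_mul]
        exact neg_mem hfg
    exact ⟨⟨_, hmem⟩, rfl, HomogeneousAlgebra.yonedaMul_toE _ f g _ (Or.inl ⟨hj, rfl⟩)⟩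
  · rw [HomogeneousAlgebra.yonedaMul_toE _ f g 0
      (Or.inr ⟨HomogeneousAlgebra.jump_add_lt h2 hi hj, rfl⟩), map_zero]
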